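/- Work in Gödel–Bernays set theory $\mathrm{GB}$ (without choice). Let $\mathbb P$ be the class forcing whose conditions are the functions $p\colon n\to\mathrm{Ord}$ with $n\in\omega$, ordered by end-extension (so that $\mathbb P$ adds a cofinal function $\omega\to\mathrm{Ord}$ by initial segments). Let $\mathcal G$ be the group of all sequences $\pi=\langle\pi_n\mid n<\omega\rangle$ of permutations $\pi_n$ of $\mathrm{Ord}$, each moving only set-many ordinals, acting on $\mathbb P$ by $\operatorname{dom}\pi(p)=\operatorname{dom}p$ and $\pi(p)(n)=\pi_n(p(n))$, and let $\mathcal F=\{\mathcal G\}$ be the trivial filter of subgroups. Then: 1. $\mathcal S=\langle\mathbb P,\mathcal G,\mathcal F\rangle$ is a class symmetric system. 2. $\mathbb P$ is not pretame: it is not the case that for every $p\in\mathbb P$ and every class sequence $\langle D_i\mid i\in I\rangle$ of dense subclasses of $\mathbb P$ with $I$ a set, there are $q\le p$ and a set $\langle d_i\mid i\in I\rangle$ with each $d_i\subseteq D_i$ predense below $q$. 3. $\mathcal S$ adds no new classes: $\mathcal S$ admits forcing relations, and for every (hereditarily symmetric) class $\mathcal S$-name $\dot\Gamma$ there is a class $A$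 such that $\check A=\{\langle\check x,1\rangle\mid x\in A\}$ is an $\mathcal S$-name and $1\Vdash_{\mathcal S}\dot\Gamma=\check A$. 4. $\mathcal S$ is pretame: $\mathcal S$ admits forcing relations, and $1$ forces over $\mathcal S$ the axioms of Separation and Collection for every class $\mathcal S$-name. 5. $\mathcal S$ is not combinatorially pretame: the property in (2) already fails for some class sequence $\langle D_i\mid i\in I\rangle$ of dense subclasses of $\mathbb P$, with $I$ a set, that is symmetric. Here, with $\mathrm{HS}$ the class of hereditarily symmetric set names, symmetric means that $I\subseteq\mathrm{HS}$, the name $\{\langle x,1\rangle\mid x\in I\}$ is symmetric, and there is $H\in\mathcal F$ such that $\pi[D_i]=D_{\pi(i)}$ for all $\pi\in H$ and $i\in I$. Here "$\mathcal S$ admits forcing relations" means that there is a class forcing relation for atomic formulas on $\mathrm{HS}$, and that for every finite list of first-order formulas with fixed class $\mathcal S$-names as class parameters, the forcing relation of $\mathcal S$ for these formulas is a class. -/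

import Mathlib

/-- First-order formulas of the two-sorted language of sets and classes, with set variables `xᵢ`
and class variables `Xᵢ` (`i : ℕ`) and without class quantifiers. The remaining connectives, the
universal quantifier and equality of classes are abbreviations, see below. -/
inductive Fml : Type where
  /-- `xᵢ ∈ xⱼ` -/
  | mem (i j : ℕ) : Fml
  /-- `xᵢ = xⱼ` -/
  | eq (i j : ℕ) : Fml
  /-- `xᵢ ∈ Xₖ` -/
  | memC (i k : ℕ) : Fml
  /-- conjunction -/
  | and (φ ψ : Fml) : Fml
  /-- negation -/
  | neg (φ : Fml) : Fml
  /-- `∃ xᵢ, φ` -/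
  | ex (i : ℕ) (φ : Fml) : Fml

namespace Fml

/-- Disjunction. -/
def or (φ ψ : Fml) : Fml := neg (and (neg φ) (neg ψ))

/-- Implication. -/
def imp (φ ψ : Fml) : Fml := neg (and φ (neg ψ))

/-- Equivalence. -/
def iff (φ ψ : Fml) : Fml := and (imp φ ψ) (imp ψ φ)

/-- `∀ xᵢ, φ`. -/
def all (i : ℕ) (φ : Fml) : Fml := neg (ex i (neg φ))

/-- `Xₖ = Xₗ`, that is `∀ x₀, x₀ ∈ Xₖ ↔ x₀ ∈ Xₗ`. -/
def eqC (k l : ℕ) : Fml := all 0 (iff (memC 0 k) (memC 0 l))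

/-- `x_s = {x_u, x_v}`; the bound variable is `x₉`, so `s, u, v` must be different from `9`. -/
def isUnordered (s u v : ℕ) : Fml := all 9 (iff (mem 9 s) (or (eq 9 u) (eq 9 v)))

/-- `x_w = ⟨x_u, x_v⟩` (Kuratowski pair); the bound variables are `x₈, x₉`, so `w, u, v` must be
different from `8` and `9`. -/
def isPair (w u v : ℕ) : Fml :=
  all 8 (iff (mem 8 w) (or (isUnordered 8 u u) (isUnordered 8 u v)))

/-- `⟨x_u, x_v⟩ ∈ X₀`; the bound variables are `x₇, x₈, x₉`, so `u, v` must be different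
from them. -/
def pairMemC (u v : ℕ) : Fml := ex 7 (and (memC 7 0) (isPair 7 u v))

/-- The instance of Separation for `X₀`: `∀ x ∃ y, y = x ∩ X₀`. -/
def separationFml : Fml :=
  all 0 (ex 1 (all 2 (iff (mem 2 1) (and (mem 2 0) (memC 2 0)))))

/-- `X₀` is a relation: all of its elements are ordered pairs. -/
def isRelation : Fml := all 4 (imp (memC 4 0) (ex 2 (ex 3 (isPair 4 2 3))))

/-- The instance of Collection for `X₀`: for all `x`, if `X₀` is a relation and
`∀ u ∈ x ∃ v, ⟨u, v⟩ ∈ X₀`, then `∃ y ∀ u ∈ x ∃ v ∈ y, ⟨u, v⟩ ∈ X₀`. -/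
def collectionFml : Fml :=
  all 0 (imp
    (and isRelation (all 2 (imp (mem 2 0) (ex 3 (pairMemC 2 3)))))
    (ex 1 (all 2 (imp (mem 2 0) (ex 3 (and (mem 3 1) (pairMemC 2 3)))))))

/-- The set variables that occur free. -/
def freeVars : Fml → Finset ℕ
  | mem i j => {i, j}
  | eq i j => {i, j}
  | memC i _ => {i}
  | and φ ψ => freeVars φ ∪ freeVars ψ
  | neg φ => freeVars φ
  | ex i φ => (freeVars φ).erase i

/-- Satisfaction of a formula, when `v` interprets the set variables and `C` the class variables. -/
def Sat {V : Type*} [Membership V V] : Fml → (ℕ → V) → (ℕ → Set V) → Prop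
  | mem i j, v, _ => v i ∈ v j
  | eq i j, v, _ => v i = v j
  | memC i k, v, C => v i ∈ C k
  | and φ ψ, v, C => Sat φ v C ∧ Sat ψ v C
  | neg φ, v, C => ¬ Sat φ v C
  | ex i φ, v, C => ∃ x, Sat φ (Function.update v i x) C

end Fml

/-- `z` is the Kuratowski pair `{{a}, {a, b}}`. -/
def IsOrderedPair {V : Type*} [Membership V V] (z a b : V) : Prop :=
  ∀ w : V, w ∈ z ↔ (∀ t : V, t ∈ w ↔ t = a ∨ t = a) ∨ (∀ t : V, t ∈ w ↔ t = a ∨ t = b)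

/-- `V` is (the domain of sets of) a model of Gödel-Bernays set theory without choice. The classes
of the model are identified with their extensions, so that extensionality for classes is built in.
The model is arbitrary; neither `∈` nor the natural numbers of the model need be standard. -/
class GBModel (V : Type*) extends Membership V V where
  /-- The subcollections of `V` that are classes of the model. -/
  IsClass : Set V → Prop
  extensionality : ∀ x y : V, (∀ z : V, z ∈ x ↔ z ∈ y) → x = y
  regularity : ∀ x : V, (∃ y : V, y ∈ x) → ∃ y : V, y ∈ x ∧ ∀ z : V, z ∈ y → ¬ z ∈ x
  pairing : ∀ a b : V, ∃ z : V, ∀ w : V, w ∈ z ↔ w = a ∨ w = b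
  union : ∀ x : V, ∃ u : V, ∀ z : V, z ∈ u ↔ ∃ y : V, y ∈ x ∧ z ∈ y
  infinity : ∃ x : V, (∃ e : V, e ∈ x ∧ ∀ z : V, ¬ z ∈ e) ∧
    ∀ y : V, y ∈ x → ∃ s : V, s ∈ x ∧ ∀ z : V, z ∈ s ↔ z ∈ y ∨ z = y
  powerset : ∀ x : V, ∃ u : V, ∀ z : V, z ∈ u ↔ ∀ w : V, w ∈ z → w ∈ x
  /-- Every set represents a class. -/
  isClass_set : ∀ a : V, IsClass {x : V | x ∈ a}
  separation : ∀ (a : V) (A : Set V), IsClass A → ∃ b : V, ∀ x : V, x ∈ b ↔ x ∈ a ∧ x ∈ A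
  collection : ∀ (a : V) (R : Set V), IsClass R →
    (∀ x : V, x ∈ a → ∃ y : V, ∃ z ∈ R, IsOrderedPair z x y) →
    ∃ b : V, ∀ x : V, x ∈ a → ∃ y : V, y ∈ b ∧ ∃ z ∈ R, IsOrderedPair z x y
  /-- First-order class comprehension, with set and class parameters. -/
  comprehension : ∀ (φ : Fml) (v : ℕ → V) (C : ℕ → Set V), (∀ k, IsClass (C k)) →
    IsClass {x : V | φ.Sat (Function.update v 0 x) C}

namespace GBModel

variable {V : Type*} [GBModel V]

theorem exists_empty : ∃ e : V, ∀ z : V, ¬ z ∈ e := by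
  obtain ⟨x, ⟨e, _, h⟩, _⟩ := infinity (V := V)
  exact ⟨e, h⟩

theorem exists_orderedPair (a b : V) : ∃ z : V, IsOrderedPair z a b := by
  obtain ⟨s, hs⟩ := pairing a a
  obtain ⟨t, ht⟩ := pairing a b
  obtain ⟨z, hz⟩ := pairing s t
  refine ⟨z, fun w => ⟨fun h => ?_, fun h => ?_⟩⟩
  · rcases (hz w).1 h with rfl | rfl
    · exact Or.inl hs
    · exact Or.inr ht
  · refine (hz w).2 ?_
    rcases h with h | h
    · exact Or.inl (extensionality _ _ fun u => (h u).trans (hs u).symm)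
    · exact Or.inr (extensionality _ _ fun u => (h u).trans (ht u).symm)

theorem exists_succ (a : V) : ∃ s : V, ∀ z : V, z ∈ s ↔ z ∈ a ∨ z = a := by
  obtain ⟨t, ht⟩ := pairing a a
  obtain ⟨q, hq⟩ := pairing a t
  obtain ⟨u, hu⟩ := union q
  refine ⟨u, fun z => (hu z).trans ⟨?_, ?_⟩⟩
  · rintro ⟨y, hy, hz⟩
    rcases (hq y).1 hy with rfl | rfl
    · exact Or.inl hz
    · exact Or.inr (by simpa using (ht z).1 hz)
  · rintro (hz | rfl)
    · exact ⟨a, (hq a).2 (Or.inl rfl), hz⟩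
    · exact ⟨t, (hq t).2 (Or.inr rfl), (ht z).2 (Or.inl rfl)⟩

/-- The empty set of the model. -/
noncomputable def empty : V := Classical.choose (exists_empty (V := V))

/-- The ordered pair `⟨a, b⟩` in the model. -/
noncomputable def pair (a b : V) : V := Classical.choose (exists_orderedPair a b)

/-- The successor `a ∪ {a}` in the model. -/
noncomputable def succ (a : V) : V := Classical.choose (exists_succ a)

theorem not_mem_empty (z : V) : ¬ z ∈ (empty : V) :=
  Classical.choose_spec (exists_empty (V := V)) z

theorem pair_spec (a b : V) : IsOrderedPair (pair a b) a b :=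
  Classical.choose_spec (exists_orderedPair a b)

theorem mem_succ (a z : V) : z ∈ succ a ↔ z ∈ a ∨ z = a :=
  Classical.choose_spec (exists_succ a) z

/-- A binary relation that is (coded by) a class. -/
def IsClass₂ (R : V → V → Prop) : Prop :=
  IsClass {z : V | ∃ a b, R a b ∧ z = pair a b}

/-- A ternary relation that is (coded by) a class. -/
def IsClass₃ (R : V → V → V → Prop) : Prop :=
  IsClass {z : V | ∃ a b c, R a b c ∧ z = pair a (pair b c)}

/-- `x` is an ordinal: a transitive set of transitive sets. -/
def IsOrd (x : V) : Prop :=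
  (∀ y : V, y ∈ x → ∀ z : V, z ∈ y → z ∈ x) ∧
  ∀ w : V, w ∈ x → ∀ y : V, y ∈ w → ∀ z : V, z ∈ y → z ∈ w

/-- `n` is a natural number (an element of `ω`): an ordinal such that it and all of its elements
are zero or successors. -/
def IsNat (n : V) : Prop :=
  IsOrd n ∧ ∀ m : V, m = n ∨ m ∈ n → m = empty ∨ ∃ k : V, m = succ k

/-- The numerals of the model. -/
noncomputable def num : ℕ → V
  | 0 => empty
  | n + 1 => succ (num n)

/-- The internalization `⌜φ⌝` of a formula, as a parse tree. -/
noncomputable def code : Fml → V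
  | .mem i j => pair (num 0) (pair (num i) (num j))
  | .eq i j => pair (num 1) (pair (num i) (num j))
  | .memC i k => pair (num 2) (pair (num i) (num k))
  | .and φ ψ => pair (num 3) (pair (code φ) (code ψ))
  | .neg φ => pair (num 4) (code φ)
  | .ex i φ => pair (num 5) (pair (num i) (code φ))

/-- The finite tuple of the values under `v` of the free set variables of `φ`, in increasing order
of the variables. -/
noncomputable def tuple (φ : Fml) (v : ℕ → V) : V :=
  (φ.freeVars.sort (· ≤ ·)).foldr (fun i t => pair (v i) t) empty

/-! ### Names -/

/-- `y = π(x)` for a set-size name `x`, where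
`π(x) = {⟨π(w), π(p)⟩ | ⟨w, p⟩ ∈ x}` recursively: some set function `f` that is closed under passing
to the names in the domain of a name obeys the recursion and maps `x` to `y`. -/
def IsNameImage (π : V → V → Prop) (x y : V) : Prop :=
  ∃ f : V, pair x y ∈ f ∧ (∀ z : V, z ∈ f → ∃ u v, z = pair u v) ∧
    (∀ u v v' : V, pair u v ∈ f → pair u v' ∈ f → v = v') ∧
    ∀ u v : V, pair u v ∈ f →
      (∀ w p : V, pair w p ∈ u → ∃ w', pair w w' ∈ f) ∧
      ∀ z : V, z ∈ v ↔
        ∃ w p w' p' : V, pair w p ∈ u ∧ pair w w' ∈ f ∧ π p p' ∧ z = pair w' p'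

/-- `π(Γ) = {⟨π(w), π(p)⟩ | ⟨w, p⟩ ∈ Γ}` for a class name `Γ`. -/
def classNameImage (π : V → V → Prop) (Γ : Set V) : Set V :=
  {z | ∃ w p w' p' : V, pair w p ∈ Γ ∧ IsNameImage π w w' ∧ π p p' ∧ z = pair w' p'}

/-- `y` is the canonical name of `x` with respect to the weakest condition `one`:
`y = {⟨w̌, one⟩ | w ∈ x}` recursively. -/
def IsCheckName (one x y : V) : Prop :=
  ∃ f : V, pair x y ∈ f ∧ (∀ z : V, z ∈ f → ∃ u v, z = pair u v) ∧
    (∀ u v v' : V, pair u v ∈ f → pair u v' ∈ f → v = v') ∧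
    ∀ u v : V, pair u v ∈ f →
      (∀ w : V, w ∈ u → ∃ w', pair w w' ∈ f) ∧
      ∀ z : V, z ∈ v ↔ ∃ w w' : V, w ∈ u ∧ pair w w' ∈ f ∧ z = pair w' one

/-- The canonical name `{⟨x̌, one⟩ | x ∈ A}` of a class `A`. -/
def classCheckName (one : V) (A : Set V) : Set V :=
  {z | ∃ x y : V, x ∈ A ∧ IsCheckName one x y ∧ z = pair y one}

end GBModel

/-- The data of a class symmetric system; the laws are in `IsClassSymmetricSystem`.
The automorphism with index `a` is the relation `autC a`, and the basic subgroup with index `a`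
consists of the automorphisms with an index `d` such that `filC a d`. -/
structure SystemData (V : Type*) where
  /-- The conditions. -/
  P : Set V
  /-- The ordering of the conditions. -/
  le : V → V → Prop
  /-- The weakest condition. -/
  one : V
  /-- The class that parametrizes the group: `autC a p q` says that `π_a(p) = q`. -/
  autC : V → V → V → Prop
  /-- The class that parametrizes the base of the filter: `filC a d` says `⟨a, d⟩ ∈ C_F`. -/
  filC : V → V → Prop

/-- The three kinds of atomic formulas for which the atomic forcing relation is defined. -/
inductive AtomRel : Type where
  | mem
  | sub
  | eq

namespace SystemData

open GBModel

variable {V : Type*} [GBModel V] (S : SystemData V)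

/-- `D` is dense in the forcing notion. -/
def IsDense (D : Set V) : Prop := D ⊆ S.P ∧ ∀ p ∈ S.P, ∃ q ∈ D, S.le q p

/-- `D` is dense below `p`. -/
def DenseBelow (D : Set V) (p : V) : Prop := ∀ s, S.le s p → ∃ q ∈ D, S.le q s

/-- `D` is predense below `q`: every `r ≤ q` is compatible with some element of `D`. -/
def PredenseBelow (D : Set V) (q : V) : Prop :=
  ∀ r, S.le r q → ∃ d ∈ D, ∃ t, S.le t r ∧ S.le t d

/-- The indices of automorphisms, `dom C_G`. -/
def autIdx : Set V := {a | ∃ p q, S.autC a p q}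

/-- The indices of basic subgroups, `dom C_F`. -/
def filIdx : Set V := {a | ∃ d, S.filC a d}

/-- The group `G = {π_a | a ∈ dom C_G}`. -/
def group : Set (V → V → Prop) := {π | ∃ a ∈ S.autIdx, π = S.autC a}

/-- The basic subgroup `H_a`. -/
def basic (a : V) : Set (V → V → Prop) := {π | ∃ d, S.filC a d ∧ π = S.autC d}

/-- The relation `π` is (the graph of) an automorphism of the forcing notion. -/
def IsAutomorphism (π : V → V → Prop) : Prop :=
  (∀ p q, π p q → p ∈ S.P ∧ q ∈ S.P) ∧
  (∀ p ∈ S.P, ∃! q, π p q) ∧ (∀ q ∈ S.P, ∃! p, π p q) ∧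
  ∀ p q p' q', π p p' → π q q' → (S.le p q ↔ S.le p' q')

/-- The identity on the conditions. -/
def idMap : V → V → Prop := fun p q => p ∈ S.P ∧ p = q

/-- The composition `π ∘ σ` of relations seen as maps. -/
def compMap (π σ : V → V → Prop) : V → V → Prop := fun p q => ∃ r, σ p r ∧ π r q

/-- The inverse of a relation seen as a map. -/
def invMap (π : V → V → Prop) : V → V → Prop := fun p q => π q p

/-- `K` is a subgroup of `G`. -/
def IsSubgroup (K : Set (V → V → Prop)) : Prop :=
  K ⊆ S.group ∧ S.idMap ∈ K ∧
  (∀ π ∈ K, ∀ σ ∈ K, compMap π σ ∈ K) ∧ ∀ π ∈ K, invMap π ∈ K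

/-- `S` is a class symmetric system: a class preorder with a weakest element, a group of
automorphisms parametrized by sets, and a base, parametrized by sets, of a normal filter of
subgroups. -/
structure IsClassSymmetricSystem : Prop where
  isClass_P : IsClass S.P
  isClass_le : IsClass₂ S.le
  le_mem : ∀ p q, S.le p q → p ∈ S.P ∧ q ∈ S.P
  le_refl : ∀ p ∈ S.P, S.le p p
  le_trans : ∀ p q r, S.le p q → S.le q r → S.le p r
  one_mem : S.one ∈ S.P
  le_one : ∀ p ∈ S.P, S.le p S.one
  isClass_aut : IsClass₃ S.autC
  aut : ∀ a ∈ S.autIdx, S.IsAutomorphism (S.autC a)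
  group_isSubgroup : S.IsSubgroup S.group
  isClass_fil : IsClass₂ S.filC
  fil_idx : ∀ a d, S.filC a d → d ∈ S.autIdx
  basic_isSubgroup : ∀ a ∈ S.filIdx, S.IsSubgroup (S.basic a)
  exists_basic_eq_group : ∃ b ∈ S.filIdx, S.basic b = S.group
  exists_basic_subset_inter :
    ∀ a ∈ S.filIdx, ∀ b ∈ S.filIdx, ∃ c ∈ S.filIdx, S.basic c ⊆ S.basic a ∩ S.basic b
  normal : ∀ a ∈ S.filIdx, ∀ d ∈ S.autIdx, ∃ c ∈ S.filIdx,
    S.basic c ⊆ {τ | ∃ σ ∈ S.basic a, τ = compMap (S.autC d) (compMap σ (invMap (S.autC d)))}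

/-- The filter `F`: the subgroups `H` of `G` of the form `{π_b | b ∈ C}` for some class `C` of
indices, that include a basic subgroup. -/
def filter : Set (Set (V → V → Prop)) :=
  {H | S.IsSubgroup H ∧
    (∃ C : Set V, IsClass C ∧ C ⊆ S.autIdx ∧ H = {π | ∃ b ∈ C, π = S.autC b}) ∧
    ∃ a ∈ S.filIdx, S.basic a ⊆ H}

/-- The set-size name `x` is symmetric. -/
def SymmetricName (x : V) : Prop := {π | π ∈ S.group ∧ IsNameImage π x x} ∈ S.filter

/-- The class name `Γ` is symmetric. -/
def SymmetricClassName (Γ : Set V) : Prop :=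
  {π | π ∈ S.group ∧ classNameImage π Γ = Γ} ∈ S.filter

/-- The class of hereditarily symmetric set-size names: `x ∈ HS` if `x` is a symmetric name with
`dom x ⊆ HS`, recursively. The recursion is expressed by a set `t` that contains `x` and is closed
under passing to the names in the domain of a name. -/
def HS : Set V :=
  {x | ∃ t : V, x ∈ t ∧ ∀ u : V, u ∈ t →
    (∀ z : V, z ∈ u → ∃ y p : V, y ∈ t ∧ p ∈ S.P ∧ z = pair y p) ∧ S.SymmetricName u}

/-- `Γ` is a class `S`-name (hereditarily symmetric class name). -/
def IsClassName (Γ : Set V) : Prop :=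
  IsClass Γ ∧ (∀ z ∈ Γ, ∃ y ∈ S.HS, ∃ p ∈ S.P, z = pair y p) ∧ S.SymmetricClassName Γ

/-! ### Forcing relations -/

/-- `R` is a forcing relation for atomic formulas; `R p ρ x y` stands for `p ⊩ x ρ y`. -/
structure IsAtomicForcing (R : V → AtomRel → V → V → Prop) : Prop where
  isClass : ∀ ρ, IsClass₃ fun p x y => R p ρ x y
  mem_iff : ∀ p ∈ S.P, ∀ x ∈ S.HS, ∀ y ∈ S.HS,
    (R p .mem x y ↔
      S.DenseBelow {q | q ∈ S.P ∧ ∃ z r : V, pair z r ∈ y ∧ S.le q r ∧ R q .eq x z} p)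
  sub_iff : ∀ p ∈ S.P, ∀ x ∈ S.HS, ∀ y ∈ S.HS,
    (R p .sub x y ↔
      ∀ z r : V, pair z r ∈ x → ∀ s, S.le s p → S.le s r → ∃ q, S.le q s ∧ R q .mem z y)
  eq_iff : ∀ p ∈ S.P, ∀ x ∈ S.HS, ∀ y ∈ S.HS,
    (R p .eq x y ↔ R p .sub x y ∧ R p .sub y x)

/-- `p ⊩ φ`, where `R` is the atomic forcing relation and the variables of `φ` are interpreted by
the set names `v` and the class names `Γ`. -/
def Forces (R : V → AtomRel → V → V → Prop) : Fml → V → (ℕ → V) → (ℕ → Set V) → Prop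
  | .mem i j, p, v, _ => R p .mem (v i) (v j)
  | .eq i j, p, v, _ => R p .eq (v i) (v j)
  | .memC i k, p, v, Γ => ∀ q, S.le q p → ∃ r, S.le r q ∧
      ∃ z s : V, pair z s ∈ Γ k ∧ S.le r s ∧ R r .eq (v i) z
  | .and φ ψ, p, v, Γ => Forces R φ p v Γ ∧ Forces R ψ p v Γ
  | .neg φ, p, v, Γ => ∀ q, S.le q p → ¬ Forces R φ q v Γ
  | .ex i φ, p, v, Γ => ∀ q, S.le q p → ∃ r, S.le r q ∧
      ∃ z ∈ S.HS, Forces R φ r (Function.update v i z) Γ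

/-- `S` admits forcing relations, where `R` is the forcing relation for atomic formulas: for any
finite list of first-order formulas with fixed class names as class parameters, some class `F`
satisfies `⟨p, ⌜φ⌝, x⟩ ∈ F ↔ p ⊩ φ(x)` for all `φ` in the list. -/
def AdmitsForcingRelations (R : V → AtomRel → V → V → Prop) : Prop :=
  S.IsAtomicForcing R ∧
  ∀ (L : List Fml) (Γ : ℕ → Set V), (∀ k, S.IsClassName (Γ k)) →
    ∃ F : Set V, IsClass F ∧ ∀ φ ∈ L, ∀ p ∈ S.P, ∀ v : ℕ → V, (∀ i, v i ∈ S.HS) →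
      (pair p (pair (code φ) (tuple φ v)) ∈ F ↔ S.Forces R φ p v Γ)

/-- `S` is pretame: it admits forcing relations, and the weakest condition forces Separation and
Collection for every class name. -/
def Pretame : Prop :=
  ∃ R, S.AdmitsForcingRelations R ∧
    ∀ Γ : Set V, S.IsClassName Γ → ∀ v : ℕ → V, (∀ i, v i ∈ S.HS) →
      S.Forces R .separationFml S.one v (fun _ => Γ) ∧
      S.Forces R .collectionFml S.one v (fun _ => Γ)

/-- `S` does not add new classes: it admits forcing relations, and every class name is forced by
the weakest condition to be equal to a class of the ground model. -/
def AddsNoNewClasses : Prop :=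
  ∃ R, S.AdmitsForcingRelations R ∧
    ∀ Γ : Set V, S.IsClassName Γ → ∃ A : Set V, IsClass A ∧
      S.IsClassName (classCheckName S.one A) ∧
      ∀ v : ℕ → V, (∀ i, v i ∈ S.HS) →
        S.Forces R (.eqC 0 1) S.one v (fun k => if k = 0 then Γ else classCheckName S.one A)

/-! ### Combinatorial pretameness -/

/-- The `i`-th member `D_i = {d | ⟨i, d⟩ ∈ D}` of the sequence coded by `D`. -/
def sect (D : Set V) (i : V) : Set V := {d | pair i d ∈ D}

/-- The class `D` codes a sequence, indexed by the set `I`, of dense subclasses of the forcing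
notion. -/
def IsDenseSequence (I : V) (D : Set V) : Prop :=
  IsClass D ∧ (∀ z ∈ D, ∃ i d : V, i ∈ I ∧ d ∈ S.P ∧ z = pair i d) ∧
  ∀ i : V, i ∈ I → S.IsDense (sect D i)

/-- The sequence coded by `D` with index set `I` is symmetric: `I ⊆ HS`, the name
`{⟨x, 1⟩ | x ∈ I}` is symmetric, and for some `H ∈ F`, `π[D_i] = D_{π(i)}` for all `π ∈ H`
and `i ∈ I`. -/
def IsSymmetricSequence (I : V) (D : Set V) : Prop :=
  (∀ i : V, i ∈ I → i ∈ S.HS) ∧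
  S.SymmetricClassName {z | ∃ i : V, i ∈ I ∧ z = pair i S.one} ∧
  ∃ H ∈ S.filter, ∀ π ∈ H, ∀ i : V, i ∈ I → ∃ j : V, j ∈ I ∧ IsNameImage π i j ∧
    {q | ∃ p ∈ sect D i, π p q} = sect D j

/-- Below every condition there is some `q` and a set `⟨d_i | i ∈ I⟩` such that each `d_i ⊆ D_i` is
predense below `q`. -/
def HasPredenseRefinements (I : V) (D : Set V) : Prop :=
  ∀ p ∈ S.P, ∃ q, S.le q p ∧ ∃ s : V, ∀ i : V, i ∈ I →
    {d | pair i d ∈ s} ⊆ sect D i ∧ S.PredenseBelow {d | pair i d ∈ s} q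

/-- The forcing notion underlying `S` is pretame. -/
def PretameForcing : Prop :=
  ∀ (I : V) (D : Set V), S.IsDenseSequence I D → S.HasPredenseRefinements I D

/-- `S` is combinatorially pretame. -/
def CombinatoriallyPretame : Prop :=
  ∀ (I : V) (D : Set V), S.IsDenseSequence I D → S.IsSymmetricSequence I D →
    S.HasPredenseRefinements I D

end SystemData

/-! ### The example -/

namespace GBModel

variable {V : Type*} [GBModel V]

/-- `p` is a function from some natural number to the class of ordinals. -/
def IsCondition (p : V) : Prop :=
  ∃ n : V, IsNat n ∧ (∀ z : V, z ∈ p → ∃ k α : V, k ∈ n ∧ IsOrd α ∧ z = pair k α) ∧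
    ∀ k : V, k ∈ n → ∃! α : V, pair k α ∈ p

/-- The set `a` codes a sequence `⟨π_n | n ∈ ω⟩` of permutations of the class of ordinals, each
moving only set-many ordinals: for every `n`, the set `{⟨α, β⟩ | ⟨n, ⟨α, β⟩⟩ ∈ a}` is a permutation
of some set of ordinals (outside of which `π_n` is the identity). -/
def IsPermSeq (a : V) : Prop :=
  (∀ z : V, z ∈ a → ∃ n α β : V, IsNat n ∧ IsOrd α ∧ IsOrd β ∧ z = pair n (pair α β)) ∧
  (∀ n α β β' : V, pair n (pair α β) ∈ a → pair n (pair α β') ∈ a → β = β') ∧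
  (∀ n α α' β : V, pair n (pair α β) ∈ a → pair n (pair α' β) ∈ a → α = α') ∧
  ∀ n α : V, (∃ β, pair n (pair α β) ∈ a) ↔ ∃ β, pair n (pair β α) ∈ a

/-- `π_n(α) = β`, where `a` codes `⟨π_n | n ∈ ω⟩`. -/
def PermMaps (a n α β : V) : Prop :=
  pair n (pair α β) ∈ a ∨ ((¬ ∃ γ, pair n (pair α γ) ∈ a) ∧ α = β)

variable (V) in
/-- The system given by the forcing notion of all functions from some natural number to the
ordinals, ordered by end-extension, the group of all sequences `⟨π_n | n ∈ ω⟩` of permutations of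
the ordinals moving only set-many ordinals, which act by `π(p)(n) = π_n(p(n))`, and the trivial
filter consisting of the whole group only. -/
noncomputable def cofinalSystem : SystemData V where
  P := {p | IsCondition p}
  le q p := IsCondition q ∧ IsCondition p ∧ ∀ z : V, z ∈ p → z ∈ q
  one := empty
  autC a p q := IsPermSeq a ∧ IsCondition p ∧ IsCondition q ∧
    (∀ n : V, (∃ α, pair n α ∈ p) ↔ ∃ β, pair n β ∈ q) ∧
    ∀ n α β : V, pair n α ∈ p → pair n β ∈ q → PermMaps a n α β
  filC b d := b = empty ∧ IsPermSeq d

end GBModel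

/-!
The forcing notion is homogeneous with respect to the whole group: given conditions `s` and `r`, one
extends `s` to a condition `t` at least as long as `r`, and transpositions in each coordinate below
the length of `r` move `r` to the restriction of `t` (`IsCondition.exists_moves`). The only group in
the filter is the whole group, so hereditarily symmetric names are fixed by all of it. Hence, if
`⟨z, r⟩` belongs to such a name `x`, then it is dense that some `⟨z, r'⟩ ∈ x` has its condition `r'`
in the generic filter (`exists_le_of_pair_mem`, and `exists_le_of_pair_mem_class` for class names).

So the conditions occurring in symmetric names carry no information. Let `val` be the evaluation
that ignores them, `val x = {val w | ⟨w, p⟩ ∈ x}`. Then every condition forces `φ` of some names, with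
class names as class parameters, if and only if `φ` holds in the ground model of their evaluations
(`forces_iff`); the evaluation is onto because of the canonical names. This gives the forcing
relations as classes (`admitsForcingRelations`), the absence of new classes (`addsNoNewClasses`), and
Separation and Collection, which are inherited from the ground model (`pretame`).

Combinatorial pretameness fails for the sequence, indexed by the canonical names of the natural
numbers, of the dense classes of all conditions with `n` in their domain. If `q` has length `n`, and
`d` is a set of conditions with `n` in their domain, then some ordinal `α` is not a value at `n` of any
element of `d`, and extending `q` by the value `α` at `n` gives a condition incompatible with all
elements of `d` (`exists_not_hasPredenseRefinements`).

The model is arbitrary, so every class and every recursion has to come from first-order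
comprehension. Definability of a predicate is the type class `Dfn`, whose instances follow the
structure of the predicate; the recursion theorem (`exists_recFun`) is used on `ω` for transitive
closures, which give induction along `∈`, and then for `val` and the canonical names.
-/

-- definability of long formulas is found by type class synthesis
set_option synthInstance.maxSize 2000

/-! ### Renaming variables in formulas -/

namespace Fml

/-- Rename the set variables by `f` and the class variables by `g`, bound variables included. -/
def rename (f g : ℕ → ℕ) : Fml → Fml
  | mem i j => mem (f i) (f j)
  | eq i j => eq (f i) (f j)
  | memC i k => memC (f i) (g k)
  | and φ ψ => and (rename f g φ) (rename f g ψ)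
  | neg φ => neg (rename f g φ)
  | ex i φ => ex (f i) (rename f g φ)

theorem sat_rename {V : Type*} [Membership V V] {f : ℕ → ℕ} (hf : Function.Injective f)
    (g : ℕ → ℕ) (φ : Fml) (v : ℕ → V) (C : ℕ → Set V) :
    (φ.rename f g).Sat v C ↔ φ.Sat (v ∘ f) (C ∘ g) := by
  induction φ generalizing v with
  | mem i j => rfl
  | eq i j => rfl
  | memC i k => rfl
  | and φ ψ ihφ ihψ => exact and_congr (ihφ v) (ihψ v)
  | neg φ ih => exact not_congr (ih v)
  | ex i φ ih =>
    refine exists_congr fun x => (ih _).trans ?_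
    rw [Function.update_comp_eq_of_injective _ hf]

theorem sat_congr {V : Type*} [Membership V V] (φ : Fml) {v w : ℕ → V} (C : ℕ → Set V)
    (h : ∀ i ∈ φ.freeVars, v i = w i) : φ.Sat v C ↔ φ.Sat w C := by
  induction φ generalizing v w with
  | mem i j => simp only [Sat, h i (by simp [freeVars]), h j (by simp [freeVars])]
  | eq i j => simp only [Sat, h i (by simp [freeVars]), h j (by simp [freeVars])]
  | memC i k => simp only [Sat, h i (by simp [freeVars])]
  | and φ ψ ihφ ihψ =>
    exact and_congr (ihφ fun i hi => h i (by simp [freeVars, hi]))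
      (ihψ fun i hi => h i (by simp [freeVars, hi]))
  | neg φ ih => exact not_congr (ih h)
  | ex i φ ih =>
    refine exists_congr fun x => ih fun j hj => ?_
    by_cases hji : j = i
    · subst hji; simp
    · simp only [Function.update_of_ne hji]
      exact h j (by simp [freeVars, hji, hj])

end Fml

open SystemData

namespace GBModel

variable {V : Type*} [GBModel V]

/-! ### Definability -/

/-- Put `x` in front of the environment `e`. -/
def push (x : V) (e : ℕ → V) : ℕ → V
  | 0 => x
  | n + 1 => e n

/-- A predicate of environments `e : ℕ → V` is definable if it is given by a first-order formula
with class parameters. The closure conditions follow the shape of formulas in de Bruijn notation: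
a quantifier binds the entry `0` of the environment and shifts the others. -/
class inductive Dfn : ((ℕ → V) → Prop) → Prop
  | var_mem (i j : ℕ) : Dfn fun e => e i ∈ e j
  | var_eq (i j : ℕ) : Dfn fun e => e i = e j
  | var_memC (i : ℕ) (A : Set V) (hA : IsClass A) : Dfn fun e => e i ∈ A
  | protected and {R R' : (ℕ → V) → Prop} (h : Dfn R) (h' : Dfn R') : Dfn fun e => R e ∧ R' e
  | protected not {R : (ℕ → V) → Prop} (h : Dfn R) : Dfn fun e => ¬ R e
  | push_ex {R : (ℕ → V) → Prop} (h : Dfn R) : Dfn fun e => ∃ x, R (push x e)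

namespace Dfn

/-- Every definable predicate is given by a formula with named variables. -/
theorem exists_fml {R : (ℕ → V) → Prop} (h : Dfn R) :
    ∃ (φ : Fml) (C : ℕ → Set V), (∀ k, IsClass (C k)) ∧ ∀ e, φ.Sat e C ↔ R e := by
  have h0 : IsClass {x : V | x ∈ (empty : V)} := isClass_set _
  induction h with
  | var_mem i j => exact ⟨.mem i j, fun _ => _, fun _ => h0, fun e => Iff.rfl⟩
  | var_eq i j => exact ⟨.eq i j, fun _ => _, fun _ => h0, fun e => Iff.rfl⟩
  | var_memC i A hA => exact ⟨.memC i 0, fun _ => A, fun _ => hA, fun e => Iff.rfl⟩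
  | @and R R' _ _ ih ih' =>
    obtain ⟨φ, C, hC, h⟩ := ih
    obtain ⟨φ', C', hC', h'⟩ := ih'
    -- the class parameters of the two formulas are interleaved
    refine ⟨.and (φ.rename id (2 * ·)) (φ'.rename id (2 * · + 1)),
      fun k => if k % 2 = 0 then C (k / 2) else C' (k / 2), fun k => ?_, fun e => ?_⟩
    · dsimp only; split_ifs
      exacts [hC _, hC' _]
    · simp only [Fml.Sat, Fml.sat_rename Function.injective_id, Function.comp_id]
      rw [← h, ← h']
      refine and_congr (iff_of_eq ?_) (iff_of_eq ?_) <;> congr 1 <;> funext k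
      · simp
      · have h1 : (2 * k + 1) % 2 ≠ 0 := by omega
        have h2 : (2 * k + 1) / 2 = k := by omega
        simp only [Function.comp, h1, if_false, h2]
  | not _ ih =>
    obtain ⟨φ, C, hC, h⟩ := ih
    exact ⟨.neg φ, C, hC, fun e => not_congr (h e)⟩
  | @push_ex R _ ih =>
    obtain ⟨φ, C, hC, h⟩ := ih
    -- move the entry `0` to a place `N` beyond the free variables, and shift the others down
    set N := φ.freeVars.sup id with hN
    have hle : ∀ i ∈ φ.freeVars, i ≤ N := fun i hi => Finset.le_sup (f := id) hi
    set f : ℕ → ℕ := fun i => if i = 0 then N else if i ≤ N then i - 1 else i with hf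
    have hinj : Function.Injective f := by
      intro i j hij
      simp only [hf] at hij
      split_ifs at hij <;> omega
    refine ⟨.ex N (φ.rename f id), C, hC, fun e => exists_congr fun x => ?_⟩
    rw [Fml.sat_rename hinj, ← h]
    refine Fml.sat_congr _ _ fun i hi => ?_
    have := hle i hi
    rcases i with _ | i
    · simp [hf, push]
    · have h1 : f (i + 1) = i := by simp [hf]; omega
      have h2 : i ≠ N := by omega
      simp [h1, h2, push]

theorem congr {R R' : (ℕ → V) → Prop} (h : Dfn R) (hR : ∀ e, R' e ↔ R e) : Dfn R' := by
  rwa [show R' = R from funext fun e => propext (hR e)]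

theorem reindex {R : (ℕ → V) → Prop} (h : Dfn R) (f : ℕ → ℕ) : Dfn fun e => R fun n => e (f n) := by
  induction h generalizing f with
  | var_mem i j => exact var_mem _ _
  | var_eq i j => exact var_eq _ _
  | var_memC i A hA => exact var_memC _ A hA
  | and _ _ ih ih' => exact (ih f).and (ih' f)
  | not _ ih => exact (ih f).not
  | @push_ex R _ ih =>
    refine (push_ex (ih (fun n => Nat.casesOn n 0 fun m => f m + 1))).congr fun e =>
      exists_congr fun x => iff_of_eq (congrArg R (funext fun n => ?_))
    cases n <;> rfl

instance ex {R : (ℕ → V) → V → Prop} [h : Dfn fun e => R (fun n => e (n + 1)) (e 0)] :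
    Dfn fun e => ∃ x, R e x :=
  push_ex h

instance inst_not {R : (ℕ → V) → Prop} [h : Dfn R] : Dfn fun e => ¬ R e := h.not

instance inst_and {R R' : (ℕ → V) → Prop} [h : Dfn R] [h' : Dfn R'] : Dfn fun e => R e ∧ R' e :=
  h.and h'

instance or {R R' : (ℕ → V) → Prop} [h : Dfn R] [h' : Dfn R'] : Dfn fun e => R e ∨ R' e :=
  (h.not.and h'.not).not.congr fun _ => by tauto

instance imp {R R' : (ℕ → V) → Prop} [h : Dfn R] [h' : Dfn R'] : Dfn fun e => R e → R' e :=
  (h.and h'.not).not.congr fun _ => by tauto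

instance iff {R R' : (ℕ → V) → Prop} [h : Dfn R] [h' : Dfn R'] : Dfn fun e => (R e ↔ R' e) :=
  (imp.and imp : Dfn fun e => (R e → R' e) ∧ (R' e → R e)).congr fun _ => by tauto

instance all {R : (ℕ → V) → V → Prop} [h : Dfn fun e => R (fun n => e (n + 1)) (e 0)] :
    Dfn fun e => ∀ x, R e x :=
  (push_ex h.not).not.congr fun _ => not_exists_not.symm

end Dfn

/-- A function of environments is definable if its graph is; the value is the entry `0` of the
environment, and the argument the rest of it. -/
class DfnFun (f : (ℕ → V) → V) : Prop where
  out : Dfn fun e => e 0 = f fun n => e (n + 1)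

instance DfnFun.var (i : ℕ) : DfnFun fun e : ℕ → V => e i := ⟨Dfn.var_eq 0 (i + 1)⟩

instance DfnFun.const (a : V) : DfnFun fun _ : ℕ → V => a := by
  -- the set parameter `a` is expressed through the class of its elements
  have h : Dfn fun e : ℕ → V => e 0 ∈ {x : V | x ∈ a} := Dfn.var_memC 0 _ (isClass_set a)
  have h1 : Dfn fun e : ℕ → V => e 0 ∈ e 1 := Dfn.var_mem 0 1
  refine ⟨Dfn.congr (Dfn.all (R := fun e x => x ∈ e 0 ↔ x ∈ {x : V | x ∈ a})
    (h := Dfn.iff (h := h1) (h' := h))) fun e => ?_⟩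
  exact ⟨fun h x => by rw [h]; rfl, fun h => extensionality _ _ h⟩

theorem DfnFun.reindex {f : (ℕ → V) → V} (h : DfnFun f) (r : ℕ → ℕ) :
    DfnFun fun e => f fun n => e (r n) :=
  ⟨(h.out.reindex fun n => Nat.casesOn n 0 fun m => r m + 1)⟩

theorem Dfn.ex_eq {f : (ℕ → V) → V} (hf : DfnFun f) {R : (ℕ → V) → V → Prop}
    (h : Dfn fun e => R (fun n => e (n + 1)) (e 0)) : Dfn fun e => R e (f e) :=
  (Dfn.ex (R := fun e x => x = f e ∧ R e x) (h := hf.out.and h)).congr fun e => by simp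

/-- Substitution of definable functions for all variables. -/
theorem Dfn.comp {R : (ℕ → V) → Prop} (h : Dfn R) {g : ℕ → (ℕ → V) → V}
    (hg : ∀ i, DfnFun (g i)) : Dfn fun e => R fun i => g i e := by
  induction h generalizing g with
  | var_mem i j =>
    refine Dfn.ex_eq (R := fun e x => x ∈ g j e) (hg i) ?_
    exact Dfn.ex_eq (R := fun e x => e 0 ∈ x) ((hg j).reindex _) (Dfn.var_mem 1 0)
  | var_eq i j =>
    refine Dfn.ex_eq (R := fun e x => x = g j e) (hg i) ?_
    exact Dfn.ex_eq (R := fun e x => e 0 = x) ((hg j).reindex _) (Dfn.var_eq 1 0)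
  | var_memC i A hA => exact Dfn.ex_eq (R := fun e x => x ∈ A) (hg i) (Dfn.var_memC 0 A hA)
  | and _ _ ih ih' => exact (ih hg).and (ih' hg)
  | not _ ih => exact (ih hg).not
  | @push_ex R _ ih =>
    refine (push_ex (ih (g := fun i => Nat.casesOn i (fun e => e 0)
      fun j e => g j fun n => e (n + 1)) fun i => ?_)).congr fun e =>
      exists_congr fun x => iff_of_eq (congrArg R (funext fun n => ?_))
    · cases i with
      | zero => exact DfnFun.var 0
      | succ j => exact (hg j).reindex _
    · cases n <;> rfl

theorem DfnFun.comp {F : (ℕ → V) → V} (h : DfnFun F) {g : ℕ → (ℕ → V) → V}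
    (hg : ∀ i, DfnFun (g i)) : DfnFun fun e => F fun i => g i e := by
  refine ⟨(h.out.comp (g := fun i => Nat.casesOn i (fun e => e 0)
      fun j e => g j fun n => e (n + 1)) fun i => ?_)⟩
  cases i with
  | zero => exact DfnFun.var 0
  | succ j => exact (hg j).reindex _

/-- Definable unary predicates. -/
class Dfn₁ (R : V → Prop) : Prop where
  out : Dfn fun e : ℕ → V => R (e 0)

/-- Definable binary relations. -/
class Dfn₂ (R : V → V → Prop) : Prop where
  out : Dfn fun e : ℕ → V => R (e 0) (e 1)

/-- Definable ternary relations. -/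
class Dfn₃ (R : V → V → V → Prop) : Prop where
  out : Dfn fun e : ℕ → V => R (e 0) (e 1) (e 2)

/-- Definable quaternary relations. -/
class Dfn₄ (R : V → V → V → V → Prop) : Prop where
  out : Dfn fun e : ℕ → V => R (e 0) (e 1) (e 2) (e 3)

/-- Definable unary functions. -/
class DfnFun₁ (f : V → V) : Prop where
  out : DfnFun fun e : ℕ → V => f (e 0)

/-- Definable binary functions. -/
class DfnFun₂ (f : V → V → V) : Prop where
  out : DfnFun fun e : ℕ → V => f (e 0) (e 1)

section inst

variable {f g h k : (ℕ → V) → V} [hf : DfnFun f] [hg : DfnFun g] [hh : DfnFun h] [hk : DfnFun k]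

instance Dfn.app₁ {R : V → Prop} [H : Dfn₁ R] : Dfn fun e => R (f e) :=
  H.out.comp (g := fun _ => f) fun _ => hf

instance Dfn.app₂ {R : V → V → Prop} [H : Dfn₂ R] : Dfn fun e => R (f e) (g e) := by
  refine H.out.comp (g := fun | 0 => f | _ => g) fun i => ?_
  rcases i with _ | i <;> assumption

instance Dfn.app₃ {R : V → V → V → Prop} [H : Dfn₃ R] : Dfn fun e => R (f e) (g e) (h e) := by
  refine H.out.comp (g := fun | 0 => f | 1 => g | _ => h) fun i => ?_
  rcases i with _ | _ | i <;> assumption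

instance Dfn.app₄ {R : V → V → V → V → Prop} [H : Dfn₄ R] :
    Dfn fun e => R (f e) (g e) (h e) (k e) := by
  refine H.out.comp (g := fun | 0 => f | 1 => g | 2 => h | _ => k) fun i => ?_
  rcases i with _ | _ | _ | i <;> assumption

instance DfnFun.app₁ {F : V → V} [H : DfnFun₁ F] : DfnFun fun e => F (f e) :=
  H.out.comp (g := fun _ => f) fun _ => hf

instance DfnFun.app₂ {F : V → V → V} [H : DfnFun₂ F] : DfnFun fun e => F (f e) (g e) := by
  refine H.out.comp (g := fun | 0 => f | _ => g) fun i => ?_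
  rcases i with _ | i <;> assumption

instance Dfn.mem : Dfn fun e => f e ∈ g e :=
  Dfn.app₂ (R := fun x y : V => x ∈ y) (H := ⟨Dfn.var_mem 0 1⟩)

instance Dfn.eq : Dfn fun e => f e = g e :=
  Dfn.app₂ (R := fun x y : V => x = y) (H := ⟨Dfn.var_eq 0 1⟩)

instance Dfn.memC {A : Set V} [hA : Fact (IsClass A)] : Dfn fun e => f e ∈ A :=
  Dfn.app₁ (R := fun x : V => x ∈ A) (H := ⟨Dfn.var_memC 0 A hA.out⟩)

end inst

/-- Class comprehension for definable predicates. -/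
theorem isClass_setOf (P : V → Prop) [h : Dfn fun e : ℕ → V => P (e 0)] : IsClass {x | P x} := by
  obtain ⟨φ, C, hC, h⟩ := h.exists_fml
  have := comprehension φ (fun _ => empty) C hC
  simpa only [h, Function.update_self] using this

/-- Separation for definable predicates. -/
theorem exists_sep (a : V) (P : V → Prop) [h : Dfn fun e : ℕ → V => P (e 0)] :
    ∃ b : V, ∀ x, x ∈ b ↔ x ∈ a ∧ P x :=
  separation a _ (isClass_setOf P)

instance : Dfn₃ (IsOrderedPair : V → V → V → Prop) := ⟨by unfold IsOrderedPair; infer_instance⟩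

theorem isOrderedPair_unique {z z' a b : V} (h : IsOrderedPair z a b) (h' : IsOrderedPair z' a b) :
    z = z' :=
  extensionality _ _ fun w => (h w).trans (h' w).symm

theorem eq_pair_iff {z a b : V} : z = pair a b ↔ IsOrderedPair z a b :=
  ⟨fun h => h ▸ pair_spec a b, fun h => isOrderedPair_unique h (pair_spec a b)⟩

instance : DfnFun₂ (pair : V → V → V) :=
  ⟨⟨by simp only [eq_pair_iff]; infer_instance⟩⟩

theorem eq_succ_iff {z a : V} : z = succ a ↔ ∀ w, w ∈ z ↔ w ∈ a ∨ w = a :=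
  ⟨fun h => h ▸ mem_succ a, fun h => extensionality _ _ fun w => (h w).trans (mem_succ a w).symm⟩

instance : DfnFun₁ (succ : V → V) :=
  ⟨⟨by simp only [eq_succ_iff]; infer_instance⟩⟩

instance : Dfn₁ (IsOrd : V → Prop) := ⟨by unfold IsOrd; infer_instance⟩

instance : Dfn₁ (IsNat : V → Prop) := ⟨by unfold IsNat; infer_instance⟩

instance : Dfn₁ (IsCondition : V → Prop) := ⟨by unfold IsCondition ExistsUnique; infer_instance⟩

instance : Dfn₁ (IsPermSeq : V → Prop) := ⟨by unfold IsPermSeq; infer_instance⟩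

instance : Dfn₄ (PermMaps : V → V → V → V → Prop) := ⟨by unfold PermMaps; infer_instance⟩

/-! ### Elementary set theory in the model -/

theorem pair_inj {a b c d : V} : pair a b = pair c d ↔ a = c ∧ b = d := by
  refine ⟨fun h => ?_, fun ⟨h, h'⟩ => by rw [h, h']⟩
  have h1 := pair_spec a b
  have h2 := pair_spec c d
  rw [← h] at h2
  obtain ⟨s, hs⟩ := pairing a a
  obtain ⟨t, ht⟩ := pairing a b
  obtain ⟨s', hs'⟩ := pairing c c
  obtain ⟨t', ht'⟩ := pairing c d
  have e1 := (h2 s).1 ((h1 s).2 (Or.inl hs))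
  have e2 := (h2 t).1 ((h1 t).2 (Or.inr ht))
  have e3 := (h1 s').1 ((h2 s').2 (Or.inl hs'))
  have e4 := (h1 t').1 ((h2 t').2 (Or.inr ht'))
  simp only [hs, ht, hs', ht', or_self] at e1 e2 e3 e4
  have hac : a = c := by
    rcases e1 with e | e
    · exact (e a).1 rfl
    · exact ((e c).2 (Or.inl rfl)).symm
  subst hac
  refine ⟨rfl, ?_⟩
  rcases e2 with e | e
  · have hb := (e b).1 (Or.inr rfl)
    rcases e4 with e' | e'
    · exact hb.trans ((e' d).1 (Or.inr rfl)).symm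
    · rcases (e' d).1 (Or.inr rfl) with h | h
      exacts [hb.trans h.symm, h.symm]
  · rcases (e b).1 (Or.inr rfl) with h | h
    · rcases (e d).2 (Or.inr rfl) with h' | h'
      exacts [h.trans h'.symm, h'.symm]
    · exact h

/-- The union of the elements of `x`. -/
noncomputable def sUnion (x : V) : V := Classical.choose (union x)

theorem mem_sUnion {x z : V} : z ∈ sUnion x ↔ ∃ y, y ∈ x ∧ z ∈ y :=
  Classical.choose_spec (union x) z

theorem eq_of_mem_iff {x y : V} (h : ∀ z, z ∈ x ↔ z ∈ y) : x = y := extensionality x y h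

/-- The set `{a, b}`. -/
noncomputable def upair (a b : V) : V := Classical.choose (pairing a b)

theorem mem_upair {a b z : V} : z ∈ upair a b ↔ z = a ∨ z = b :=
  Classical.choose_spec (pairing a b) z

/-- The set `a ∪ b`. -/
noncomputable def bUnion (a b : V) : V := sUnion (upair a b)

theorem mem_bUnion {a b z : V} : z ∈ bUnion a b ↔ z ∈ a ∨ z ∈ b := by
  simp [bUnion, mem_sUnion, mem_upair]

/-- A set containing both coordinates of every ordered pair in `f`. -/
noncomputable def field (f : V) : V := sUnion (sUnion f)

theorem mem_field {f a b : V} (h : pair a b ∈ f) : a ∈ field f ∧ b ∈ field f := by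
  have h1 : upair a b ∈ sUnion f :=
    mem_sUnion.2 ⟨_, h, ((pair_spec a b) _).2 (Or.inr fun _ => mem_upair)⟩
  exact ⟨mem_sUnion.2 ⟨_, h1, mem_upair.2 (Or.inl rfl)⟩,
    mem_sUnion.2 ⟨_, h1, mem_upair.2 (Or.inr rfl)⟩⟩

theorem mem_mem_mem_of_pair_mem {f a b : V} (h : pair a b ∈ f) : ∃ x y, x ∈ f ∧ y ∈ x ∧ a ∈ y :=
  ⟨_, _, h, ((pair_spec a b) _).2 (Or.inr fun _ => mem_upair), mem_upair.2 (Or.inl rfl)⟩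

theorem exists_minimal (a : V) (P : V → Prop) [Dfn fun e : ℕ → V => P (e 0)]
    (h : ∃ x, x ∈ a ∧ P x) : ∃ x, x ∈ a ∧ P x ∧ ∀ y, y ∈ x → y ∈ a → ¬ P y := by
  obtain ⟨b, hb⟩ := exists_sep a P
  obtain ⟨y, hy, hmin⟩ := regularity b (h.imp fun x hx => (hb x).2 hx)
  exact ⟨y, ((hb y).1 hy).1, ((hb y).1 hy).2, fun z hz hza hP => hmin z hz ((hb z).2 ⟨hza, hP⟩)⟩

theorem not_mem_and_mem (a b : V) : ¬ (a ∈ b ∧ b ∈ a) := by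
  rintro ⟨h, h'⟩
  obtain ⟨y, hy, hmin⟩ := regularity (upair a b) ⟨a, mem_upair.2 (Or.inl rfl)⟩
  rcases mem_upair.1 hy with rfl | rfl
  · exact hmin b h' (mem_upair.2 (Or.inr rfl))
  · exact hmin a h (mem_upair.2 (Or.inl rfl))

theorem not_mem_self (a : V) : ¬ a ∈ a := fun h => not_mem_and_mem a a ⟨h, h⟩

/-- Collection for definable relations. -/
theorem exists_collect (a : V) (R : V → V → Prop) [H : Dfn fun e : ℕ → V => R (e 0) (e 1)]
    (h : ∀ x, x ∈ a → ∃ y, R x y) : ∃ b : V, ∀ x, x ∈ a → ∃ y, y ∈ b ∧ R x y := by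
  have : Dfn₂ R := ⟨H⟩
  obtain ⟨b, hb⟩ := collection a {z : V | ∃ x y, R x y ∧ z = pair x y} (isClass_setOf _)
    fun x hx => by
      obtain ⟨y, hy⟩ := h x hx
      exact ⟨y, pair x y, ⟨x, y, hy, rfl⟩, pair_spec x y⟩
  refine ⟨b, fun x hx => ?_⟩
  obtain ⟨y, hy, z, ⟨x', y', hR, rfl⟩, hz⟩ := hb x hx
  obtain ⟨rfl, rfl⟩ := pair_inj.1 (eq_pair_iff.2 hz)
  exact ⟨_, hy, hR⟩

/-- Replacement for definable partial functions. -/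
theorem exists_image (a : V) (R : V → V → Prop) [H : Dfn fun e : ℕ → V => R (e 0) (e 1)]
    (h : ∀ x, x ∈ a → ∀ y y', R x y → R x y' → y = y') :
    ∃ b : V, ∀ y, y ∈ b ↔ ∃ x, x ∈ a ∧ R x y := by
  have : Dfn₂ R := ⟨H⟩
  obtain ⟨a', ha'⟩ := exists_sep a fun x => ∃ y, R x y
  obtain ⟨b, hb⟩ := exists_collect a' R fun x hx => ((ha' x).1 hx).2
  obtain ⟨c, hc⟩ := exists_sep b fun y => ∃ x, x ∈ a ∧ R x y
  refine ⟨c, fun y => (hc y).trans ⟨fun h => h.2, fun ⟨x, hx, hR⟩ => ⟨?_, x, hx, hR⟩⟩⟩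
  obtain ⟨y', hy', hR'⟩ := hb x ((ha' x).2 ⟨hx, y, hR⟩)
  rwa [h x hx y y' hR hR']

/-! ### Natural numbers and ordinals -/

theorem IsOrd.of_mem {a x : V} (ha : IsOrd a) (hx : x ∈ a) : IsOrd x :=
  ⟨ha.2 x hx, fun _ hw => ha.2 _ (ha.1 x hx _ hw)⟩

theorem isOrd_empty : IsOrd (empty : V) :=
  ⟨fun y hy => (not_mem_empty y hy).elim, fun y hy => (not_mem_empty y hy).elim⟩

theorem IsOrd.succ {a : V} (ha : IsOrd a) : IsOrd (succ a) := by
  refine ⟨fun y hy z hz => (mem_succ a z).2 (Or.inl ?_), fun w hw => ?_⟩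
  · rcases (mem_succ a y).1 hy with h | rfl
    exacts [ha.1 y h z hz, hz]
  · rcases (mem_succ a w).1 hw with h | rfl
    exacts [ha.2 w h, ha.1]

theorem IsNat.of_mem {n m : V} (hn : IsNat n) (hm : m ∈ n) : IsNat m := by
  refine ⟨hn.1.of_mem hm, fun k hk => hn.2 k (Or.inr ?_)⟩
  rcases hk with rfl | hk
  exacts [hm, hn.1.1 m hm k hk]

theorem isNat_empty : IsNat (empty : V) :=
  ⟨isOrd_empty, fun m hm => Or.inl (hm.resolve_right (not_mem_empty m))⟩

theorem IsNat.succ {n : V} (hn : IsNat n) : IsNat (succ n) := by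
  refine ⟨hn.1.succ, fun m hm => ?_⟩
  rcases hm with rfl | hm
  · exact Or.inr ⟨n, rfl⟩
  · exact hn.2 m ((mem_succ n m).1 hm).symm

variable (V) in
theorem exists_omega : ∃ o : V, ∀ n, n ∈ o ↔ IsNat n := by
  obtain ⟨x, ⟨e, hex, he⟩, hs⟩ := infinity (V := V)
  obtain ⟨o, ho⟩ := exists_sep x IsNat
  refine ⟨o, fun n => (ho n).trans ⟨fun h => h.2, fun hn => ⟨?_, hn⟩⟩⟩
  by_contra hnx
  obtain ⟨m, hm, hmx, hmin⟩ := exists_minimal (succ n) (fun m => ¬ m ∈ x)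
    ⟨n, (mem_succ n n).2 (Or.inr rfl), hnx⟩
  rcases hn.2 m ((mem_succ n m).1 hm).symm with rfl | ⟨k, rfl⟩
  · have h0 : (empty : V) = e := eq_of_mem_iff fun z => by simp [he, not_mem_empty]
    exact hmx (h0 ▸ hex)
  · have hk : k ∈ x := by
      by_contra hk
      have hks : k ∈ GBModel.succ k := (mem_succ k k).2 (Or.inr rfl)
      exact hmin k hks (hn.1.succ.1 _ hm k hks) hk
    obtain ⟨s, hsx, hsk⟩ := hs k hk
    exact hmx (eq_succ_iff.2 hsk ▸ hsx)

/-- The set of natural numbers. -/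
noncomputable def omega : V := Classical.choose (exists_omega V)

theorem mem_omega {n : V} : n ∈ (omega : V) ↔ IsNat n := Classical.choose_spec (exists_omega V) n

/-! ### Recursion -/

/-- `f` is a set function whose domain is closed under passing from `u` to those `w` for which
`T u w`, and which obeys the recursion `f(u) = {z | ∃ w, T u w ∧ O u w (f w) z}`. -/
def IsRecFun (T : V → V → Prop) (O : V → V → V → V → Prop) (f : V) : Prop :=
  (∀ z : V, z ∈ f → ∃ u v, z = pair u v) ∧
    (∀ u v v' : V, pair u v ∈ f → pair u v' ∈ f → v = v') ∧
    ∀ u v : V, pair u v ∈ f →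
      (∀ w : V, T u w → ∃ w', pair w w' ∈ f) ∧
      ∀ z : V, z ∈ v ↔ ∃ w w' : V, T u w ∧ pair w w' ∈ f ∧ O u w w' z

instance (T : V → V → Prop) (O : V → V → V → V → Prop) [Dfn₂ T] [Dfn₄ O] :
    Dfn₁ (IsRecFun T O) := ⟨by unfold IsRecFun; infer_instance⟩

/-- Induction along `T` is valid for definable predicates. -/
def HasInduction (T : V → V → Prop) : Prop :=
  ∀ P : V → Prop, (Dfn fun e : ℕ → V => P (e 0)) → (∀ u, (∀ w, T u w → P w) → P u) → ∀ u, P u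

theorem IsRecFun.unique {T : V → V → Prop} {O : V → V → V → V → Prop} (hT : HasInduction T)
    {f g : V} (hf : IsRecFun T O f) (hg : IsRecFun T O g) {u v v' : V} (h : pair u v ∈ f)
    (h' : pair u v' ∈ g) : v = v' := by
  suffices ∀ u v v' : V, pair u v ∈ f → pair u v' ∈ g → v = v' from this u v v' h h'
  refine hT _ inferInstance fun u ih v v' h h' => eq_of_mem_iff fun z => ?_
  rw [(hf.2.2 u v h).2, (hg.2.2 u v' h').2]
  constructor
  · rintro ⟨w, w', hw, hp, hO⟩
    obtain ⟨w'', hp'⟩ := (hg.2.2 u v' h').1 w hw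
    exact ⟨w, w', hw, ih w hw w' w'' hp hp' ▸ hp', hO⟩
  · rintro ⟨w, w', hw, hp, hO⟩
    obtain ⟨w'', hp'⟩ := (hf.2.2 u v h).1 w hw
    exact ⟨w, w', hw, ih w hw w'' w' hp' hp ▸ hp', hO⟩

/-- The recursion theorem, for a recursion in which the values are sets. -/
theorem exists_recFun (T : V → V → Prop) (O : V → V → V → V → Prop) [Dfn₂ T] [Dfn₄ O]
    (hT : HasInduction T) (hdom : ∀ u, ∃ d : V, ∀ w, w ∈ d ↔ T u w)
    (hval : ∀ u g : V, ∃ v : V, ∀ z, (∃ w w' : V, T u w ∧ pair w w' ∈ g ∧ O u w w' z) → z ∈ v)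
    (u : V) : ∃ v f : V, IsRecFun T O f ∧ pair u v ∈ f := by
  refine hT (fun u => ∃ v f : V, IsRecFun T O f ∧ pair u v ∈ f) inferInstance (fun u ih => ?_) u
  obtain ⟨d, hd⟩ := hdom u
  -- collect recursive functions for the `w` with `T u w` and unite them
  obtain ⟨b, hb⟩ := exists_collect d (fun w f => ∃ v, IsRecFun T O f ∧ pair w v ∈ f) fun w hw => by
    obtain ⟨v, f, hf⟩ := ih w ((hd w).1 hw)
    exact ⟨f, v, hf⟩
  obtain ⟨c, hc⟩ := exists_sep b (IsRecFun T O)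
  set g := sUnion c with hg
  have hcg {f u v : V} (hf : f ∈ c) (h : pair u v ∈ f) : pair u v ∈ g := mem_sUnion.2 ⟨f, hf, h⟩
  have hfun : ∀ u v v' : V, pair u v ∈ g → pair u v' ∈ g → v = v' := by
    intro u v v' h h'
    obtain ⟨f, hf, h⟩ := mem_sUnion.1 h
    obtain ⟨f', hf', h'⟩ := mem_sUnion.1 h'
    exact IsRecFun.unique hT ((hc f).1 hf).2 ((hc f').1 hf').2 h h'
  have hrec : ∀ u v : V, pair u v ∈ g →
      (∀ w : V, T u w → ∃ w', pair w w' ∈ g) ∧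
      ∀ z : V, z ∈ v ↔ ∃ w w' : V, T u w ∧ pair w w' ∈ g ∧ O u w w' z := by
    intro u v h
    obtain ⟨f, hf, h⟩ := mem_sUnion.1 h
    have h1 := ((hc f).1 hf).2.2.2 u v h
    refine ⟨fun w hw => (h1.1 w hw).imp fun w' hw' => hcg hf hw', fun z => (h1.2 z).trans ?_⟩
    constructor
    · rintro ⟨w, w', hw, hp, hO⟩
      exact ⟨w, w', hw, hcg hf hp, hO⟩
    · rintro ⟨w, w', hw, hp, hO⟩
      obtain ⟨w'', hp'⟩ := h1.1 w hw
      exact ⟨w, w', hw, hfun w w' w'' hp (hcg hf hp') ▸ hp', hO⟩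
  have hpair : ∀ z : V, z ∈ g → ∃ u v, z = pair u v := by
    intro z h
    obtain ⟨f, hf, h⟩ := mem_sUnion.1 h
    exact ((hc f).1 hf).2.1 z h
  have hcov : ∀ w, T u w → ∃ w', pair w w' ∈ g := by
    intro w hw
    obtain ⟨f, hfb, v, hf, h⟩ := hb w ((hd w).2 hw)
    exact ⟨v, hcg ((hc f).2 ⟨hfb, hf⟩) h⟩
  by_cases hu : ∃ v, pair u v ∈ g
  · obtain ⟨v, hv⟩ := hu
    exact ⟨v, g, ⟨hpair, hfun, hrec⟩, hv⟩
  obtain ⟨v₀, hv₀⟩ := hval u g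
  obtain ⟨v, hv⟩ := exists_sep v₀ fun z => ∃ w w' : V, T u w ∧ pair w w' ∈ g ∧ O u w w' z
  set f := bUnion g (upair (pair u v) (pair u v)) with hf
  have hmf {z : V} : z ∈ f ↔ z ∈ g ∨ z = pair u v := by simp [hf, mem_bUnion, mem_upair]
  -- `u` is not related to elements of the domain of `g`, including itself
  have key {u' v' w w' : V} (h : pair u' v' ∈ g) (hw : T u' w) (h' : pair w w' ∈ f) :
      pair w w' ∈ g := by
    rcases hmf.1 h' with h1 | h1
    · exact h1
    · obtain ⟨rfl, rfl⟩ := pair_inj.1 h1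
      exact (hu ((hrec u' v' h).1 _ hw)).elim
  have key' {w w' : V} (hw : T u w) (h' : pair w w' ∈ f) : pair w w' ∈ g := by
    rcases hmf.1 h' with h1 | h1
    · exact h1
    · obtain ⟨rfl, rfl⟩ := pair_inj.1 h1
      exact (hu (hcov _ hw)).elim
  refine ⟨v, f, ⟨fun z hz => ?_, fun u' v' v'' h h' => ?_, fun u' v' h => ?_⟩, hmf.2 (Or.inr rfl)⟩
  · rcases hmf.1 hz with h | h
    exacts [hpair z h, ⟨_, _, h⟩]
  · rcases hmf.1 h with h | h <;> rcases hmf.1 h' with h' | h'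
    · exact hfun _ _ _ h h'
    · exact (hu ⟨v', (pair_inj.1 h').1 ▸ h⟩).elim
    · exact (hu ⟨v'', (pair_inj.1 h).1 ▸ h'⟩).elim
    · rw [(pair_inj.1 h).2, (pair_inj.1 h').2]
  · rcases hmf.1 h with h | h
    · refine ⟨fun w hw => ((hrec u' v' h).1 w hw).imp fun w' hw' => hmf.2 (Or.inl hw'),
        fun z => ((hrec u' v' h).2 z).trans ?_⟩
      exact exists_congr fun w => exists_congr fun w' => and_congr_right fun hw =>
        and_congr_left fun _ => ⟨fun h => hmf.2 (Or.inl h), key h hw⟩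
    · obtain ⟨rfl, rfl⟩ := pair_inj.1 h
      refine ⟨fun w hw => (hcov w hw).imp fun w' hw' => hmf.2 (Or.inl hw'),
        fun z => (hv z).trans ?_⟩
      refine ⟨fun ⟨_, w, w', hw, hp, hO⟩ => ⟨w, w', hw, hmf.2 (Or.inl hp), hO⟩,
        fun ⟨w, w', hw, hp, hO⟩ => ?_⟩
      exact ⟨hv₀ z ⟨w, w', hw, key' hw hp, hO⟩, w, w', hw, key' hw hp, hO⟩

theorem hasInduction_nat : HasInduction fun n m : V => IsNat n ∧ m ∈ n := by
  intro P hP h u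
  have hP₁ : Dfn₁ P := ⟨hP⟩
  by_cases hu : IsNat u
  · by_contra hPu
    obtain ⟨m, hm, hmP, hmin⟩ := exists_minimal (omega : V) (fun m => ¬ P m)
      ⟨u, mem_omega.2 hu, hPu⟩
    exact hmP (h m fun w hw => not_not.1 (hmin w hw.2 (mem_omega.2 (hw.1.of_mem hw.2))))
  · exact h u fun w hw => (hu hw.1).elim

/-- Every set is included in a transitive set, which is the union of the sets `f(n)`, `n ∈ ω`,
given by `f(n) = ⋃ {{x} ∪ ⋃ f(m) | m < n}`. -/
theorem exists_transitive (x : V) : ∃ t : V, x ∈ t ∧ ∀ y, y ∈ t → ∀ z, z ∈ y → z ∈ t := by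
  set T : V → V → Prop := fun n m => IsNat n ∧ m ∈ n
  set O : V → V → V → V → Prop := fun _ _ w' z => z = x ∨ ∃ y, y ∈ w' ∧ z ∈ y
  have : Dfn₂ T := ⟨inferInstance⟩
  have : Dfn₄ O := ⟨inferInstance⟩
  have hrec := exists_recFun T O hasInduction_nat (fun u => ?_) fun u g => ?_
  · -- the union of the values at the natural numbers
    obtain ⟨r, hr⟩ := exists_image (omega : V) (fun n v => ∃ f : V, IsRecFun T O f ∧ pair n v ∈ f)
      fun n _ v v' ⟨f, hf, h⟩ ⟨f', hf', h'⟩ => hf.unique hasInduction_nat hf' h h'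
    have key {n v z : V} (hn : IsNat n) (h : ∃ f : V, IsRecFun T O f ∧ pair n v ∈ f)
        (hz : z = x ∨ ∃ y, y ∈ v ∧ z ∈ y) : z ∈ sUnion r := by
      obtain ⟨f, hf, hfn⟩ := h
      obtain ⟨v', f', hf', h'⟩ := hrec (succ n)
      refine mem_sUnion.2 ⟨v', (hr _).2 ⟨_, mem_omega.2 hn.succ, f', hf', h'⟩, ?_⟩
      have hT : T (succ n) n := ⟨hn.succ, (mem_succ n n).2 (Or.inr rfl)⟩
      obtain ⟨w', hw'⟩ := (hf'.2.2 _ _ h').1 n hT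
      rw [(hf'.2.2 _ _ h').2]
      refine ⟨n, w', hT, hw', ?_⟩
      rwa [← hf.unique hasInduction_nat hf' hfn hw']
    refine ⟨sUnion r, ?_, fun y hy z hz => ?_⟩
    · obtain ⟨v, hv⟩ := hrec empty
      exact key isNat_empty hv (Or.inl rfl)
    · obtain ⟨v, hv, hyv⟩ := mem_sUnion.1 hy
      obtain ⟨n, hn, hf⟩ := (hr v).1 hv
      exact key (mem_omega.1 hn) hf (Or.inr ⟨y, hyv, hz⟩)
  · obtain ⟨d, hd⟩ := exists_sep u fun _ => IsNat u
    exact ⟨d, fun w => (hd w).trans and_comm⟩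
  · refine ⟨bUnion (upair x x) (sUnion (sUnion (field g))), ?_⟩
    rintro z ⟨w, w', -, hp, rfl | ⟨y, hy, hz⟩⟩
    · exact mem_bUnion.2 (Or.inl (mem_upair.2 (Or.inl rfl)))
    · exact mem_bUnion.2 (Or.inr (mem_sUnion.2 ⟨y, mem_sUnion.2 ⟨w', (mem_field hp).2, hy⟩, hz⟩))

theorem hasInduction_mem : HasInduction fun u w : V => w ∈ u := by
  intro P hP h u
  have hP₁ : Dfn₁ P := ⟨hP⟩
  by_contra hPu
  obtain ⟨t, hut, ht⟩ := exists_transitive u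
  obtain ⟨m, hm, hmP, hmin⟩ := exists_minimal t (fun m => ¬ P m) ⟨u, hut, hPu⟩
  exact hmP (h m fun w hw => not_not.1 (hmin w hw (ht m hm w hw)))

/-- Induction for names: `P` follows for a name from `P` for the names in its domain. -/
theorem hasInduction_name : HasInduction fun u w : V => ∃ p, pair w p ∈ u := by
  intro P hP h u
  have hP₁ : Dfn₁ P := ⟨hP⟩
  -- the domain of `u` lies three levels below `u` in the hierarchy of `∈`
  refine And.left (hasInduction_mem
    (fun u => P u ∧ (∀ a, a ∈ u → P a) ∧ ∀ a b, a ∈ u → b ∈ a → P b) inferInstance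
    (fun u ih => ⟨h u fun w hw => ?_, fun a ha => (ih a ha).1, fun a b ha hb => (ih a ha).2.1 b hb⟩)
    u)
  obtain ⟨p, hp⟩ := hw
  obtain ⟨x, y, hx, hy, hw⟩ := mem_mem_mem_of_pair_mem hp
  exact (ih x hx).2.2 y w hy hw

/-! ### Comparison of ordinals, and codes of formulas -/

theorem IsOrd.trichotomy {a b : V} (ha : IsOrd a) (hb : IsOrd b) : a ∈ b ∨ a = b ∨ b ∈ a := by
  refine hasInduction_mem (fun a : V => ∀ b : V, IsOrd a → IsOrd b → a ∈ b ∨ a = b ∨ b ∈ a)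
    inferInstance (fun a iha b => ?_) a b ha hb
  refine hasInduction_mem (fun b : V => IsOrd a → IsOrd b → a ∈ b ∨ a = b ∨ b ∈ a)
    inferInstance (fun b ihb ha hb => ?_) b
  by_cases h1 : a ∈ b
  · exact Or.inl h1
  by_cases h2 : b ∈ a
  · exact Or.inr (Or.inr h2)
  refine Or.inr (Or.inl (eq_of_mem_iff fun x => ⟨fun hx => ?_, fun hx => ?_⟩))
  · rcases iha x hx b (ha.of_mem hx) hb with h | rfl | h
    exacts [h, (h2 hx).elim, (h2 (ha.1 x hx b h)).elim]
  · rcases ihb x hx ha (hb.of_mem hx) with h | rfl | h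
    exacts [(h1 (hb.1 x hx a h)).elim, (h1 hx).elim, h]

/-- The ordinals form a proper class. -/
theorem exists_isOrd_not_mem (s : V) : ∃ α : V, IsOrd α ∧ ¬ α ∈ s := by
  by_contra! h
  obtain ⟨o, ho⟩ := exists_sep s IsOrd
  have ho' (x : V) : x ∈ o ↔ IsOrd x := (ho x).trans ⟨fun h => h.2, fun hx => ⟨h x hx, hx⟩⟩
  refine not_mem_self o ((ho' o).2 ⟨fun y hy z hz => ?_, fun w hw => ((ho' w).1 hw).1⟩)
  exact (ho' z).2 (((ho' y).1 hy).of_mem hz)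

theorem num_injective : Function.Injective (num : ℕ → V) := by
  have key : ∀ m n : ℕ, m < n → (num m : V) ∈ (num n : V) := by
    intro m n h
    induction n with
    | zero => omega
    | succ n ih =>
      refine (mem_succ _ _).2 ?_
      rcases Nat.lt_succ_iff_lt_or_eq.1 h with h | rfl
      exacts [Or.inl (ih h), Or.inr rfl]
  intro m n h
  rcases lt_trichotomy m n with h' | h' | h'
  · exact (not_mem_self (num n : V) (h ▸ key m n h')).elim
  · exact h'
  · exact (not_mem_self (num n : V) (h ▸ key n m h')).elim

theorem code_injective : Function.Injective (code : Fml → V) := by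
  intro φ
  induction φ with
  | mem i j => intro ψ h; cases ψ <;> simp_all [code, pair_inj, num_injective.eq_iff]
  | eq i j => intro ψ h; cases ψ <;> simp_all [code, pair_inj, num_injective.eq_iff]
  | memC i j => intro ψ h; cases ψ <;> simp_all [code, pair_inj, num_injective.eq_iff]
  | and φ φ' ih ih' =>
    intro ψ h
    cases ψ <;> simp only [code, pair_inj, num_injective.eq_iff] at h <;> try omega
    rw [ih h.2.1, ih' h.2.2]
  | neg φ ih =>
    intro ψ h
    cases ψ <;> simp only [code, pair_inj, num_injective.eq_iff] at h <;> try omega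
    rw [ih h.2]
  | ex i φ ih =>
    intro ψ h
    cases ψ <;> simp only [code, pair_inj, num_injective.eq_iff] at h <;> try omega
    rw [h.2.1, ih h.2.2]

/-! ### Evaluation of names and canonical names -/

theorem exists_val (u : V) : ∃ v f : V,
    IsRecFun (fun u w => ∃ p, pair w p ∈ u) (fun _ _ w' z => z = w') f ∧ pair u v ∈ f := by
  have : Dfn₂ fun u w : V => ∃ p, pair w p ∈ u := ⟨inferInstance⟩
  have : Dfn₄ fun _ _ w' z : V => z = w' := ⟨inferInstance⟩
  refine exists_recFun _ _ hasInduction_name (fun u => ?_) (fun u g => ⟨field g, ?_⟩) u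
  · obtain ⟨d, hd⟩ := exists_sep (field u) fun w => ∃ p, pair w p ∈ u
    exact ⟨d, fun w => (hd w).trans
      (and_iff_right_of_imp fun h => h.elim fun p hp => (mem_field hp).1)⟩
  · rintro z ⟨w, w', -, hp, rfl⟩
    exact (mem_field hp).2

/-- The evaluation of a name in which the conditions are ignored:
`val x = {val w | ⟨w, p⟩ ∈ x}`. -/
noncomputable def val (u : V) : V := Classical.choose (exists_val u)

theorem eq_val_iff {u z : V} : z = val u ↔ ∃ f : V,
    IsRecFun (fun u w => ∃ p, pair w p ∈ u) (fun _ _ w' z => z = w') f ∧ pair u z ∈ f := by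
  have h := Classical.choose_spec (exists_val u)
  refine ⟨fun hz => hz ▸ h, fun ⟨f, hf, hz⟩ => ?_⟩
  obtain ⟨g, hg, hv⟩ := h
  exact hf.unique hasInduction_name hg hz hv

theorem mem_val {u z : V} : z ∈ val u ↔ ∃ w p, pair w p ∈ u ∧ z = val w := by
  obtain ⟨f, hf, h⟩ := eq_val_iff.1 (rfl : val u = val u)
  have h' := hf.2.2 _ _ h
  rw [h'.2]
  constructor
  · rintro ⟨w, w', ⟨p, hw⟩, hp, rfl⟩
    exact ⟨w, p, hw, eq_val_iff.2 ⟨f, hf, hp⟩⟩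
  · rintro ⟨w, p, hw, rfl⟩
    obtain ⟨w', hw'⟩ := h'.1 w ⟨p, hw⟩
    exact ⟨w, w', ⟨p, hw⟩, hw', (eq_val_iff.2 ⟨f, hf, hw'⟩).symm⟩

instance : DfnFun₁ (val : V → V) := by
  have : Dfn₂ fun u w : V => ∃ p, pair w p ∈ u := ⟨inferInstance⟩
  have : Dfn₄ fun _ _ w' z : V => z = w' := ⟨inferInstance⟩
  exact ⟨⟨by simp only [eq_val_iff]; infer_instance⟩⟩

theorem isCheckName_iff {one x y : V} : IsCheckName one x y ↔ ∃ f : V,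
    IsRecFun (fun u w => w ∈ u) (fun _ _ w' z => z = pair w' one) f ∧ pair x y ∈ f :=
  exists_congr fun _ => and_comm

theorem exists_isCheckName (one x : V) : ∃ y, IsCheckName one x y := by
  simp only [isCheckName_iff]
  have : Dfn₂ fun u w : V => w ∈ u := ⟨inferInstance⟩
  have : Dfn₄ fun _ _ w' z : V => z = pair w' one := ⟨inferInstance⟩
  refine exists_recFun _ _ hasInduction_mem (fun u => ⟨u, fun w => Iff.rfl⟩) (fun u g => ?_) x
  obtain ⟨v, hv⟩ := exists_image (field g) (fun w' z => z = pair w' one)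
    fun _ _ _ _ h h' => h ▸ h'.symm
  refine ⟨v, ?_⟩
  rintro z ⟨w, w', -, hp, hz⟩
  exact (hv z).2 ⟨w', (mem_field hp).2, hz⟩

theorem IsCheckName.unique {one x y y' : V} (h : IsCheckName one x y) (h' : IsCheckName one x y') :
    y = y' := by
  obtain ⟨f, hf, h⟩ := isCheckName_iff.1 h
  obtain ⟨f', hf', h'⟩ := isCheckName_iff.1 h'
  exact hf.unique hasInduction_mem hf' h h'

theorem isCheckName_mem {one x y z : V} (h : IsCheckName one x y) :
    z ∈ y ↔ ∃ w w', w ∈ x ∧ IsCheckName one w w' ∧ z = pair w' one := by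
  obtain ⟨f, hf, h⟩ := isCheckName_iff.1 h
  have h' := hf.2.2 _ _ h
  rw [h'.2]
  constructor
  · rintro ⟨w, w', hw, hp, rfl⟩
    exact ⟨w, w', hw, isCheckName_iff.2 ⟨f, hf, hp⟩, rfl⟩
  · rintro ⟨w, w', hw, hp, rfl⟩
    obtain ⟨w'', hw''⟩ := h'.1 w hw
    exact ⟨w, w', hw, hp.unique (isCheckName_iff.2 ⟨f, hf, hw''⟩) ▸ hw'', rfl⟩

instance : Dfn₃ (IsCheckName : V → V → V → Prop) := ⟨by unfold IsCheckName; infer_instance⟩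

theorem val_of_isCheckName {one x y : V} (h : IsCheckName one x y) : val y = x := by
  refine hasInduction_mem (fun x : V => ∀ y : V, IsCheckName one x y → val y = x) inferInstance
    (fun x ih y h => ?_) x y h
  refine eq_of_mem_iff fun z => mem_val.trans ?_
  constructor
  · rintro ⟨w, p, hw, rfl⟩
    obtain ⟨a, b, ha, hb, hwp⟩ := (isCheckName_mem h).1 hw
    rw [(pair_inj.1 hwp).1, ih a ha b hb]
    exact ha
  · intro hz
    obtain ⟨w', hw'⟩ := exists_isCheckName one z
    exact ⟨w', one, (isCheckName_mem h).2 ⟨z, w', hz, hw', rfl⟩, (ih z hz w' hw').symm⟩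

/-! ### Images of names under automorphisms -/

/-- The image of a name under `π` as an instance of the recursion `IsRecFun`. -/
theorem isNameImage_iff {π : V → V → Prop} {x y : V} : IsNameImage π x y ↔ ∃ f : V,
    IsRecFun (fun u w => ∃ p, pair w p ∈ u)
      (fun u w w' z => ∃ p p', pair w p ∈ u ∧ π p p' ∧ z = pair w' p') f ∧ pair x y ∈ f := by
  refine exists_congr fun f => ?_
  rw [and_comm, IsRecFun]
  refine and_congr_left fun _ => and_congr_right fun _ => and_congr_right fun _ => ?_
  refine forall₃_congr fun u v _ => and_congr ?_ (forall_congr' fun z => iff_congr Iff.rfl ?_)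
  · exact ⟨fun h w ⟨p, hp⟩ => h w p hp, fun h w p hp => h w ⟨p, hp⟩⟩
  · constructor
    · rintro ⟨w, p, w', p', h1, h2, h3, h4⟩
      exact ⟨w, w', ⟨p, h1⟩, h2, p, p', h1, h3, h4⟩
    · rintro ⟨w, w', -, h2, p, p', h1, h3, h4⟩
      exact ⟨w, p, w', p', h1, h2, h3, h4⟩

theorem IsNameImage.unique {π : V → V → Prop} {x y y' : V} (h : IsNameImage π x y)
    (h' : IsNameImage π x y') : y = y' := by
  obtain ⟨f, hf, h⟩ := isNameImage_iff.1 h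
  obtain ⟨f', hf', h'⟩ := isNameImage_iff.1 h'
  exact hf.unique hasInduction_name hf' h h'

/-- If `π` fixes `x` and the names in its domain, then `x` is closed under moving the conditions
in its elements by `π`. -/
theorem IsNameImage.pair_mem {π : V → V → Prop} {x w p p' : V} (h : IsNameImage π x x)
    (hw : IsNameImage π w w) (hp : pair w p ∈ x) (hpp' : π p p') : pair w p' ∈ x := by
  obtain ⟨f, hf, hx⟩ := isNameImage_iff.1 h
  have h' := hf.2.2 _ _ hx
  obtain ⟨w', hw'⟩ := h'.1 w ⟨p, hp⟩
  have : w' = w := IsNameImage.unique (isNameImage_iff.2 ⟨f, hf, hw'⟩) hw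
  subst this
  exact (h'.2 _).2 ⟨w', w', ⟨p, hp⟩, hw', p, p', hp, hpp', rfl⟩

/-- Canonical names are fixed by every relation that maps the weakest condition only to itself. -/
theorem IsCheckName.isNameImage {π : V → V → Prop} {one x y : V} (h : IsCheckName one x y)
    (hπ : ∀ p, π one p ↔ p = one) : IsNameImage π y y := by
  obtain ⟨f, hf, h⟩ := isCheckName_iff.1 h
  -- the identity on the range of `f` witnesses the claim
  obtain ⟨g, hg⟩ := exists_image (field f) (fun v z => z = pair v v ∧ ∃ u, pair u v ∈ f)
    fun _ _ _ _ h h' => h.1 ▸ h'.1.symm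
  have hg' (v v' : V) : pair v v' ∈ g ↔ v = v' ∧ ∃ u, pair u v ∈ f := by
    rw [hg]
    constructor
    · rintro ⟨a, -, ha, h⟩
      obtain ⟨rfl, rfl⟩ := pair_inj.1 ha
      exact ⟨rfl, h⟩
    · rintro ⟨rfl, u, h⟩
      exact ⟨v, (mem_field h).2, rfl, u, h⟩
  refine ⟨g, (hg' y y).2 ⟨rfl, x, h⟩, fun z hz => ?_, fun u v v' h h' => ?_, fun u v hu => ?_⟩
  · obtain ⟨v, -, hv, -⟩ := (hg z).1 hz
    exact ⟨v, v, hv⟩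
  · rw [← ((hg' u v).1 h).1, ← ((hg' u v').1 h').1]
  · obtain ⟨rfl, t, ht⟩ := (hg' u v).1 hu
    have hu' := (hf.2.2 t u ht).2
    refine ⟨fun w p hwp => ?_, fun z => ⟨fun hz => ?_, ?_⟩⟩
    · obtain ⟨a, b, -, hb, hz⟩ := (hu' _).1 hwp
      obtain ⟨rfl, -⟩ := pair_inj.1 hz
      exact ⟨w, (hg' w w).2 ⟨rfl, a, hb⟩⟩
    · obtain ⟨a, b, ha, hb, rfl⟩ := (hu' _).1 hz
      exact ⟨b, one, b, one, hz, (hg' b b).2 ⟨rfl, a, hb⟩, (hπ one).2 rfl, rfl⟩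
    · rintro ⟨w, p, w', p', hwp, hww', hpp', rfl⟩
      obtain ⟨a, b, -, -, hz⟩ := (hu' _).1 hwp
      obtain ⟨-, rfl⟩ := pair_inj.1 hz
      rw [(hπ p').1 hpp', ← ((hg' w w').1 hww').1]
      exact hwp

/-! ### Projections of tuples -/

open Classical in
/-- The first coordinate of an ordered pair. -/
noncomputable def fst (z : V) : V :=
  if h : ∃ a b, z = pair a b then Classical.choose h else empty

open Classical in
/-- The second coordinate of an ordered pair. -/
noncomputable def snd (z : V) : V :=
  if h : ∃ b a, z = pair a b then Classical.choose h else empty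

theorem fst_pair (a b : V) : fst (pair a b) = a := by
  have h : ∃ c d, pair a b = pair c d := ⟨a, b, rfl⟩
  rw [fst, dif_pos h]
  obtain ⟨d, hd⟩ := Classical.choose_spec h
  exact (pair_inj.1 hd).1.symm

theorem snd_pair (a b : V) : snd (pair a b) = b := by
  have h : ∃ d c, pair a b = pair c d := ⟨b, a, rfl⟩
  rw [snd, dif_pos h]
  obtain ⟨d, hd⟩ := Classical.choose_spec h
  exact (pair_inj.1 hd).2.symm

instance : DfnFun₁ (fst : V → V) := by
  have h (y z : V) : y = fst z ↔ (∃ b, z = pair y b) ∨ (¬ ∃ a b, z = pair a b) ∧ y = empty := by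
    by_cases hz : ∃ a b, z = pair a b
    · obtain ⟨a, b, rfl⟩ := hz
      simp only [fst_pair, pair_inj]
      grind
    · rw [fst, dif_neg hz]
      grind
  exact ⟨⟨by simp only [h]; infer_instance⟩⟩

instance : DfnFun₁ (snd : V → V) := by
  have h (y z : V) : y = snd z ↔ (∃ b, z = pair b y) ∨ (¬ ∃ b a, z = pair a b) ∧ y = empty := by
    by_cases hz : ∃ b a, z = pair a b
    · obtain ⟨a, b, rfl⟩ := hz
      simp only [snd_pair, pair_inj]
      grind
    · rw [snd, dif_neg hz]
      grind
  exact ⟨⟨by simp only [h]; infer_instance⟩⟩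

/-- The entry with index `k` of a finite tuple `⟨a₀, ⟨a₁, … ⟩⟩`. -/
noncomputable def proj : ℕ → V → V
  | 0, t => fst t
  | k + 1, t => proj k (snd t)

instance (k : ℕ) : DfnFun₁ (proj k : V → V) := by
  induction k with
  | zero => exact ⟨inferInstanceAs (DfnFun fun e : ℕ → V => fst (e 0))⟩
  | succ k ih => exact ⟨inferInstanceAs (DfnFun fun e : ℕ → V => proj k (snd (e 0)))⟩

theorem proj_foldr (v : ℕ → V) (l : List ℕ) {i : ℕ} (hi : i ∈ l) :
    proj (l.idxOf i) (l.foldr (fun i t => pair (v i) t) empty) = v i := by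
  induction l with
  | nil => simp at hi
  | cons j l ih =>
    by_cases h : j = i
    · subst h
      simp [proj, fst_pair]
    · rw [List.idxOf_cons_ne _ h, List.foldr_cons, proj, snd_pair]
      exact ih ((List.mem_cons.1 hi).resolve_left (Ne.symm h))

/-! ### Definability of satisfaction of a fixed formula -/

theorem dfn_sat (φ : Fml) (C : ℕ → Set V) (hC : ∀ k, IsClass (C k)) : Dfn fun e => φ.Sat e C := by
  induction φ with
  | mem i j => exact Dfn.var_mem i j
  | eq i j => exact Dfn.var_eq i j
  | memC i k => exact Dfn.var_memC i _ (hC k)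
  | and φ ψ ihφ ihψ => exact ihφ.and ihψ
  | neg φ ih => exact ih.not
  | ex i φ ih =>
    refine (Dfn.push_ex (ih.reindex fun n => if n = i then 0 else n + 1)).congr fun e =>
      exists_congr fun x => iff_of_eq (congrArg (φ.Sat · C) (funext fun n => ?_))
    by_cases h : n = i
    · subst h; simp [push]
    · simp [h, push]

/-- The relations `φ(val x₁, …, val xₙ)`, for `φ` in a finite list, are coded by a single class. -/
theorem isClass_sat_val (L : List Fml) (C : ℕ → Set V) (hC : ∀ k, IsClass (C k)) :
    ∃ F : Set V, IsClass F ∧ ∀ φ ∈ L, ∀ (p : V) (v : ℕ → V),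
      pair p (pair (code φ) (tuple φ v)) ∈ F ↔ φ.Sat (fun i => val (v i)) C := by
  let Q (φ : Fml) (z : V) : Prop := fst (snd z) = code φ ∧
    φ.Sat (fun i => val (proj ((φ.freeVars.sort (· ≤ ·)).idxOf i) (snd (snd z)))) C
  have hQ (φ : Fml) : Dfn fun e : ℕ → V => Q φ (e 0) :=
    Dfn.inst_and (h' := (dfn_sat φ C hC).comp (g := fun i e =>
      val (proj ((φ.freeVars.sort (· ≤ ·)).idxOf i) (snd (snd (e 0))))) fun _ => inferInstance)
  have hL : Dfn fun e : ℕ → V => ∃ φ ∈ L, Q φ (e 0) := by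
    induction L with
    | nil => exact (inferInstance : Dfn fun e : ℕ → V => ¬ e 0 = e 0).congr fun e => by simp
    | cons φ L ih => exact (Dfn.or (h := hQ φ) (h' := ih)).congr fun e => by simp
  refine ⟨{z | ∃ φ ∈ L, Q φ z}, isClass_setOf _, fun φ hφ p v => ?_⟩
  have hsat : φ.Sat (fun i => val (proj ((φ.freeVars.sort (· ≤ ·)).idxOf i) (tuple φ v))) C ↔
      φ.Sat (fun i => val (v i)) C :=
    Fml.sat_congr _ _ fun i hi => by rw [tuple, proj_foldr v _ (by simpa using hi)]
  rw [← hsat]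
  constructor
  · rintro ⟨ψ, -, h1, h2⟩
    simp only [snd_pair, fst_pair] at h1 h2
    obtain rfl := code_injective h1
    exact h2
  · intro h
    refine ⟨φ, hφ, ?_, ?_⟩
    · simp only [snd_pair, fst_pair]
    · simpa only [snd_pair] using h

/-! ### Conditions -/

/-- `p` is a function from `n` to the ordinals. -/
def IsOrdFun (n p : V) : Prop :=
  (∀ z : V, z ∈ p → ∃ k α : V, k ∈ n ∧ IsOrd α ∧ z = pair k α) ∧
    ∀ k : V, k ∈ n → ∃! α : V, pair k α ∈ p

theorem isCondition_iff {p : V} : IsCondition p ↔ ∃ n, IsNat n ∧ IsOrdFun n p := Iff.rfl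

theorem IsOrdFun.of_pair_mem {n p k α : V} (h : IsOrdFun n p) (hk : pair k α ∈ p) :
    k ∈ n ∧ IsOrd α := by
  obtain ⟨k', α', hk', hα', he⟩ := h.1 _ hk
  obtain ⟨rfl, rfl⟩ := pair_inj.1 he
  exact ⟨hk', hα'⟩

theorem IsOrdFun.mem_iff {n p k : V} (h : IsOrdFun n p) : k ∈ n ↔ ∃ α, pair k α ∈ p :=
  ⟨fun hk => (h.2 k hk).exists, fun ⟨_, hα⟩ => (h.of_pair_mem hα).1⟩

theorem IsOrdFun.eq {n p k α β : V} (h : IsOrdFun n p) (hα : pair k α ∈ p) (hβ : pair k β ∈ p) :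
    α = β :=
  (h.2 k (h.of_pair_mem hα).1).unique hα hβ

theorem IsCondition.eq {p k α β : V} (h : IsCondition p) (hα : pair k α ∈ p)
    (hβ : pair k β ∈ p) : α = β := by
  obtain ⟨n, -, h⟩ := h
  exact IsOrdFun.eq h hα hβ

theorem IsCondition.isOrd {p k α : V} (h : IsCondition p) (hα : pair k α ∈ p) : IsOrd α := by
  obtain ⟨n, -, h⟩ := h
  exact (IsOrdFun.of_pair_mem h hα).2

theorem IsCondition.isNat {p k α : V} (h : IsCondition p) (hα : pair k α ∈ p) : IsNat k := by
  obtain ⟨n, hn, h⟩ := h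
  exact hn.of_mem (IsOrdFun.of_pair_mem h hα).1

theorem IsCondition.eq_pair {p z : V} (h : IsCondition p) (hz : z ∈ p) : ∃ k α, z = pair k α := by
  obtain ⟨n, -, h⟩ := h
  obtain ⟨k, α, -, -, h⟩ := h.1 z hz
  exact ⟨k, α, h⟩

theorem IsCondition.subset_iff {p q : V} (h : IsCondition p) :
    (∀ z, z ∈ p → z ∈ q) ↔ ∀ k α, pair k α ∈ p → pair k α ∈ q := by
  refine ⟨fun H k α => H _, fun H z hz => ?_⟩
  obtain ⟨k, α, rfl⟩ := h.eq_pair hz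
  exact H k α hz

theorem IsCondition.ext {p q : V} (hp : IsCondition p) (hq : IsCondition q)
    (h : ∀ k α, pair k α ∈ p ↔ pair k α ∈ q) : p = q :=
  eq_of_mem_iff fun z => ⟨hp.subset_iff.2 (fun k α => (h k α).1) z,
    hq.subset_iff.2 (fun k α => (h k α).2) z⟩

/-- A definable function from `n` to the ordinals is a set. -/
theorem exists_isOrdFun (n : V) (F : V → V → Prop) [H : Dfn fun e : ℕ → V => F (e 0) (e 1)]
    (hF : ∀ k, k ∈ n → ∃! α, F k α) (hord : ∀ k α, k ∈ n → F k α → IsOrd α) :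
    ∃ p, IsOrdFun n p ∧ ∀ k α, pair k α ∈ p ↔ k ∈ n ∧ F k α := by
  have : Dfn₂ F := ⟨H⟩
  obtain ⟨p, hp⟩ := exists_image n (fun k z => ∃ α, F k α ∧ z = pair k α) (by
    rintro k hk y y' ⟨α, hα, rfl⟩ ⟨β, hβ, rfl⟩
    rw [(hF k hk).unique hα hβ])
  have hp' : ∀ k α, pair k α ∈ p ↔ k ∈ n ∧ F k α := by
    intro k α
    rw [hp]
    constructor
    · rintro ⟨k', hk, α', hα, he⟩
      obtain ⟨rfl, rfl⟩ := pair_inj.1 he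
      exact ⟨hk, hα⟩
    · rintro ⟨hk, hα⟩
      exact ⟨k, hk, α, hα, rfl⟩
  refine ⟨p, ⟨fun z hz => ?_, fun k hk => ?_⟩, hp'⟩
  · obtain ⟨k, hk, α, hα, rfl⟩ := (hp z).1 hz
    exact ⟨k, α, hk, hord k α hk hα, rfl⟩
  · simp only [hp', hk, true_and]
    exact hF k hk

theorem isCondition_empty : IsCondition (empty : V) :=
  ⟨empty, isNat_empty, fun z hz => (not_mem_empty z hz).elim, fun k hk => (not_mem_empty k hk).elim⟩

/-- A condition `s` can be extended by the values of `r` beyond the domain of `s`. -/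
theorem IsCondition.exists_extend {s r : V} (hs : IsCondition s) (hr : IsCondition r) :
    ∃ t : V, IsCondition t ∧ (∀ z, z ∈ s → z ∈ t) ∧ ∀ k α, pair k α ∈ r → ∃ β, pair k β ∈ t := by
  obtain ⟨m, hm, hs'⟩ := isCondition_iff.1 hs
  obtain ⟨n, hn, hr'⟩ := isCondition_iff.1 hr
  by_cases hmn : m ∈ n
  · have hF : ∀ k, k ∈ n → ∃! α, pair k α ∈ s ∨ ¬ k ∈ m ∧ pair k α ∈ r := by
      intro k hk
      by_cases hkm : k ∈ m
      · simpa [hkm] using hs'.2 k hkm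
      · have (α : V) : ¬ pair k α ∈ s := fun h => hkm (hs'.of_pair_mem h).1
        simpa [hkm, this] using hr'.2 k hk
    obtain ⟨t, ht, htm⟩ := exists_isOrdFun n _ hF fun k α _ h =>
      h.elim hs.isOrd fun h => hr.isOrd h.2
    refine ⟨t, ⟨n, hn, ht⟩, hs.subset_iff.2 fun k α hk => ?_, fun k α hk => ?_⟩
    · exact (htm k α).2 ⟨hn.1.1 m hmn k (hs'.of_pair_mem hk).1, Or.inl hk⟩
    · exact ht.mem_iff.1 (hr'.of_pair_mem hk).1
  · refine ⟨s, hs, fun z hz => hz, fun k α hk => hs'.mem_iff.1 ?_⟩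
    have hkn := (hr'.of_pair_mem hk).1
    rcases hm.1.trichotomy hn.1 with h | rfl | h
    exacts [(hmn h).elim, hkn, hm.1.1 n h k hkn]

theorem IsCondition.exists_extend_mem {s n : V} (hs : IsCondition s) (hn : IsNat n) :
    ∃ t : V, IsCondition t ∧ (∀ z, z ∈ s → z ∈ t) ∧ ∃ α, pair n α ∈ t := by
  obtain ⟨r, hr, hrm⟩ := exists_isOrdFun (succ n) (fun _ α => α = empty)
    (fun k _ => ⟨empty, rfl, fun _ h => h⟩) fun _ _ _ h => h ▸ isOrd_empty
  obtain ⟨t, ht, hst, htr⟩ := hs.exists_extend ⟨succ n, hn.succ, hr⟩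
  exact ⟨t, ht, hst, htr n empty ((hrm n empty).2 ⟨(mem_succ n n).2 (Or.inr rfl), rfl⟩)⟩

/-! ### Sequences of permutations -/

theorem IsPermSeq.isOrd_iff {a n α β : V} (ha : IsPermSeq a) (h : PermMaps a n α β) :
    IsOrd α ↔ IsOrd β := by
  rcases h with h | ⟨-, rfl⟩
  · obtain ⟨n', α', β', -, h1, h2, he⟩ := ha.1 _ h
    simp only [pair_inj] at he
    obtain ⟨rfl, rfl, rfl⟩ := he
    exact iff_of_true h1 h2
  · rfl

theorem exists_permMaps (a n α : V) : ∃ β, PermMaps a n α β := by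
  by_cases h : ∃ β, pair n (pair α β) ∈ a
  · exact h.imp fun β hβ => Or.inl hβ
  · exact ⟨α, Or.inr ⟨h, rfl⟩⟩

theorem IsPermSeq.maps_unique {a n α β β' : V} (ha : IsPermSeq a) (h : PermMaps a n α β)
    (h' : PermMaps a n α β') : β = β' := by
  rcases h with h | ⟨h, rfl⟩ <;> rcases h' with h' | ⟨h', rfl⟩
  · exact ha.2.1 _ _ _ _ h h'
  · exact (h' ⟨_, h⟩).elim
  · exact (h ⟨_, h'⟩).elim
  · rfl

theorem IsPermSeq.exists_inv {a : V} (ha : IsPermSeq a) :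
    ∃ b, IsPermSeq b ∧ (∀ n α β, pair n (pair α β) ∈ b ↔ pair n (pair β α) ∈ a) ∧
      ∀ n α β, PermMaps b n α β ↔ PermMaps a n β α := by
  obtain ⟨b, hb⟩ := exists_image a
    (fun z y => ∃ n α β : V, z = pair n (pair α β) ∧ y = pair n (pair β α)) (by
      rintro z - y y' ⟨n, α, β, rfl, rfl⟩ ⟨n', α', β', h, rfl⟩
      simp only [pair_inj] at h
      obtain ⟨rfl, rfl, rfl⟩ := h
      rfl)
  have hb' : ∀ n α β, pair n (pair α β) ∈ b ↔ pair n (pair β α) ∈ a := by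
    intro n α β
    rw [hb]
    constructor
    · rintro ⟨z, hz, n', α', β', rfl, h⟩
      simp only [pair_inj] at h
      obtain ⟨rfl, rfl, rfl⟩ := h
      exact hz
    · exact fun h => ⟨_, h, n, β, α, rfl, rfl⟩
  refine ⟨b, ⟨fun z hz => ?_, ?_, ?_, ?_⟩, hb', fun n α β => ?_⟩
  · obtain ⟨y, hy, n, α, β, rfl, rfl⟩ := (hb z).1 hz
    obtain ⟨n', α', β', h1, h2, h3, h⟩ := ha.1 _ hy
    simp only [pair_inj] at h
    obtain ⟨rfl, rfl, rfl⟩ := h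
    exact ⟨n, β, α, h1, h3, h2, rfl⟩
  · simp only [hb']
    exact fun n α β β' => ha.2.2.1 n β β' α
  · simp only [hb']
    exact fun n α β β' => ha.2.1 n β' α β
  · simp only [hb']
    exact fun n α => (ha.2.2.2 n α).symm
  · simp only [PermMaps, hb', ha.2.2.2 n β]
    refine or_congr Iff.rfl ⟨?_, ?_⟩
    · rintro ⟨h, rfl⟩
      exact ⟨h, rfl⟩
    · rintro ⟨h, rfl⟩
      exact ⟨h, rfl⟩

theorem IsPermSeq.exists_maps_to {a : V} (ha : IsPermSeq a) (n β : V) :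
    ∃ α, PermMaps a n α β := by
  obtain ⟨b, -, -, hb⟩ := ha.exists_inv
  obtain ⟨α, hα⟩ := exists_permMaps b n β
  exact ⟨α, (hb n β α).1 hα⟩

theorem IsPermSeq.maps_injective {a n α α' β : V} (ha : IsPermSeq a) (h : PermMaps a n α β)
    (h' : PermMaps a n α' β) : α = α' := by
  obtain ⟨b, hb, -, hb'⟩ := ha.exists_inv
  exact hb.maps_unique ((hb' _ _ _).2 h) ((hb' _ _ _).2 h')

theorem IsPermSeq.exists_comp {a b : V} (ha : IsPermSeq a) (hb : IsPermSeq b) :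
    ∃ c, IsPermSeq c ∧
      ∀ n α β, PermMaps c n α β ↔ ∃ γ, PermMaps b n α γ ∧ PermMaps a n γ β := by
  -- the support of the composition is the union of the supports
  obtain ⟨c, hc⟩ := exists_image (bUnion a b) (fun z y => ∃ n α δ γ β : V, z = pair n (pair α δ) ∧
      PermMaps b n α γ ∧ PermMaps a n γ β ∧ y = pair n (pair α β)) (by
    rintro z - y y' ⟨n, α, δ, γ, β, rfl, h1, h2, rfl⟩ ⟨n', α', δ', γ', β', h, h1', h2', rfl⟩
    simp only [pair_inj] at h
    obtain ⟨rfl, rfl, rfl⟩ := h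
    obtain rfl := hb.maps_unique h1 h1'
    obtain rfl := ha.maps_unique h2 h2'
    rfl)
  let s (n α : V) : Prop := (∃ γ, pair n (pair α γ) ∈ a) ∨ ∃ γ, pair n (pair α γ) ∈ b
  have hc' : ∀ n α β, pair n (pair α β) ∈ c ↔
      s n α ∧ ∃ γ, PermMaps b n α γ ∧ PermMaps a n γ β := by
    intro n α β
    rw [hc]
    constructor
    · rintro ⟨z, hz, n', α', δ, γ, β', rfl, h1, h2, h⟩
      simp only [pair_inj] at h
      obtain ⟨rfl, rfl, rfl⟩ := h
      exact ⟨(mem_bUnion.1 hz).imp (fun h => ⟨_, h⟩) (fun h => ⟨_, h⟩), γ, h1, h2⟩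
    · rintro ⟨h | h, γ, h1, h2⟩ <;> obtain ⟨δ, hδ⟩ := h
      · exact ⟨_, mem_bUnion.2 (Or.inl hδ), n, α, δ, γ, β, rfl, h1, h2, rfl⟩
      · exact ⟨_, mem_bUnion.2 (Or.inr hδ), n, α, δ, γ, β, rfl, h1, h2, rfl⟩
  -- moving points of the union of the supports keeps them there
  have hsa {n α β : V} (h : PermMaps a n α β) : s n α ↔ s n β := by
    rcases h with h | ⟨-, rfl⟩
    · exact iff_of_true (Or.inl ⟨_, h⟩) (Or.inl ((ha.2.2.2 n β).2 ⟨_, h⟩))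
    · rfl
  have hsb {n α β : V} (h : PermMaps b n α β) : s n α ↔ s n β := by
    rcases h with h | ⟨-, rfl⟩
    · exact iff_of_true (Or.inr ⟨_, h⟩) (Or.inr ((hb.2.2.2 n β).2 ⟨_, h⟩))
    · rfl
  have hnat {n α : V} (h : s n α) : IsNat n ∧ IsOrd α := by
    rcases h with ⟨γ, h⟩ | ⟨γ, h⟩
    · obtain ⟨n', α', β', h1, h2, -, h⟩ := ha.1 _ h
      simp only [pair_inj] at h
      obtain ⟨rfl, rfl, rfl⟩ := h
      exact ⟨h1, h2⟩
    · obtain ⟨n', α', β', h1, h2, -, h⟩ := hb.1 _ h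
      simp only [pair_inj] at h
      obtain ⟨rfl, rfl, rfl⟩ := h
      exact ⟨h1, h2⟩
  have hdom {n α : V} : (∃ β, pair n (pair α β) ∈ c) ↔ s n α := by
    refine ⟨fun ⟨β, h⟩ => ((hc' n α β).1 h).1, fun h => ?_⟩
    obtain ⟨γ, h1⟩ := exists_permMaps b n α
    obtain ⟨β, h2⟩ := exists_permMaps a n γ
    exact ⟨β, (hc' n α β).2 ⟨h, γ, h1, h2⟩⟩
  refine ⟨c, ⟨fun z hz => ?_, fun n α β β' h h' => ?_, fun n α α' β h h' => ?_, fun n α => ?_⟩,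
    fun n α β => ?_⟩
  · obtain ⟨w, -, n, α, δ, γ, β, -, -, -, rfl⟩ := (hc z).1 hz
    obtain ⟨h, γ, h1, h2⟩ := (hc' n α β).1 hz
    exact ⟨n, α, β, (hnat h).1, (hnat h).2, (hnat ((hsa h2).1 ((hsb h1).1 h))).2, rfl⟩
  · obtain ⟨-, γ, h1, h2⟩ := (hc' n α β).1 h
    obtain ⟨-, γ', h1', h2'⟩ := (hc' n α β').1 h'
    obtain rfl := hb.maps_unique h1 h1'
    exact ha.maps_unique h2 h2'
  · obtain ⟨-, γ, h1, h2⟩ := (hc' n α β).1 h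
    obtain ⟨-, γ', h1', h2'⟩ := (hc' n α' β).1 h'
    obtain rfl := ha.maps_injective h2 h2'
    exact hb.maps_injective h1 h1'
  · rw [hdom]
    constructor
    · intro h
      obtain ⟨γ, h1⟩ := ha.exists_maps_to n α
      obtain ⟨β, h2⟩ := hb.exists_maps_to n γ
      exact ⟨β, (hc' n β α).2 ⟨(hsb h2).2 ((hsa h1).2 h), γ, h2, h1⟩⟩
    · rintro ⟨β, h⟩
      obtain ⟨h, γ, h1, h2⟩ := (hc' n β α).1 h
      exact (hsa h2).1 ((hsb h1).1 h)
  · rw [PermMaps, hdom, hc']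
    by_cases h : s n α
    · simp [h]
    · -- off the supports both permutations are the identity
      have hα : ¬ (∃ γ, pair n (pair α γ) ∈ a) ∧ ¬ ∃ γ, pair n (pair α γ) ∈ b := not_or.1 h
      simp only [h, false_and, not_false_eq_true, true_and, false_or]
      constructor
      · rintro rfl
        exact ⟨α, Or.inr ⟨hα.2, rfl⟩, Or.inr ⟨hα.1, rfl⟩⟩
      · rintro ⟨γ, h1, h2⟩
        obtain rfl := h1.elim (fun h => (hα.2 ⟨_, h⟩).elim) And.right
        exact h2.elim (fun h => (hα.1 ⟨_, h⟩).elim) And.right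

theorem isPermSeq_empty : IsPermSeq (empty : V) := by
  simp [IsPermSeq, not_mem_empty]

/-- `Moves a p q` says that the sequence of permutations coded by `a` maps the condition `p` to
`q`. -/
def Moves (a p q : V) : Prop := (cofinalSystem V).autC a p q

theorem moves_iff {a p q : V} : Moves a p q ↔ IsPermSeq a ∧ IsCondition p ∧ IsCondition q ∧
    ∀ n β, pair n β ∈ q ↔ ∃ α, pair n α ∈ p ∧ PermMaps a n α β := by
  refine and_congr_right fun ha => and_congr_right fun hp => and_congr_right fun hq => ?_
  constructor
  · rintro ⟨h1, h2⟩ n β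
    constructor
    · intro hβ
      obtain ⟨α, hα⟩ := (h1 n).2 ⟨β, hβ⟩
      exact ⟨α, hα, h2 n α β hα hβ⟩
    · rintro ⟨α, hα, h⟩
      obtain ⟨β', hβ'⟩ := (h1 n).1 ⟨α, hα⟩
      rwa [ha.maps_unique h (h2 n α β' hα hβ')]
  · intro h
    refine ⟨fun n => ⟨fun ⟨α, hα⟩ => ?_, fun ⟨β, hβ⟩ => ?_⟩, fun n α β hα hβ => ?_⟩
    · obtain ⟨β, hβ⟩ := exists_permMaps a n α
      exact ⟨β, (h n β).2 ⟨α, hα, hβ⟩⟩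
    · exact ((h n β).1 hβ).imp fun _ h => h.1
    · obtain ⟨α', hα', h'⟩ := (h n β).1 hβ
      rwa [hp.eq hα hα']

instance : Dfn₃ (Moves : V → V → V → Prop) :=
  ⟨(inferInstance : Dfn fun e : ℕ → V => IsPermSeq (e 0) ∧ IsCondition (e 1) ∧ IsCondition (e 2) ∧
    ∀ n β, pair n β ∈ e 2 ↔ ∃ α, pair n α ∈ e 1 ∧ PermMaps (e 0) n α β).congr fun _ => moves_iff⟩

theorem IsPermSeq.existsUnique_moves {a p : V} (ha : IsPermSeq a) (hp : IsCondition p) :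
    ∃! q, Moves a p q := by
  obtain ⟨n, hn, hp'⟩ := isCondition_iff.1 hp
  have hF : ∀ k, k ∈ n → ∃! β, ∃ α, pair k α ∈ p ∧ PermMaps a k α β := by
    intro k hk
    obtain ⟨α, hα⟩ := hp'.mem_iff.1 hk
    obtain ⟨β, hβ⟩ := exists_permMaps a k α
    refine ⟨β, ⟨α, hα, hβ⟩, fun β' ⟨α', hα', hβ'⟩ => ?_⟩
    obtain rfl := hp.eq hα hα'
    exact ha.maps_unique hβ' hβ
  obtain ⟨q, hq, hqm⟩ := exists_isOrdFun n _ hF fun k β _ ⟨α, hα, h⟩ =>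
    (ha.isOrd_iff h).1 (hp.isOrd hα)
  refine ⟨q, moves_iff.2 ⟨ha, hp, ⟨n, hn, hq⟩, fun k β => (hqm k β).trans ?_⟩, fun q' hq' => ?_⟩
  · exact and_iff_right_of_imp fun ⟨α, hα, _⟩ => (hp'.of_pair_mem hα).1
  · obtain ⟨-, -, hq'c, h⟩ := moves_iff.1 hq'
    refine hq'c.ext ⟨n, hn, hq⟩ fun k β => (h k β).trans ((hqm k β).trans ?_).symm
    exact and_iff_right_of_imp fun ⟨α, hα, _⟩ => (hp'.of_pair_mem hα).1

theorem IsPermSeq.exists_inv_moves {a : V} (ha : IsPermSeq a) :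
    ∃ b, IsPermSeq b ∧ ∀ p q, Moves b p q ↔ Moves a q p := by
  obtain ⟨b, hb, -, hba⟩ := ha.exists_inv
  have key {a b : V} (ha : IsPermSeq a) (hb : IsPermSeq b)
      (hba : ∀ n α β, PermMaps b n α β ↔ PermMaps a n β α) {p q : V} (h : Moves b p q) :
      Moves a q p := by
    obtain ⟨-, hp, hq, h⟩ := moves_iff.1 h
    refine moves_iff.2 ⟨ha, hq, hp, fun n α => ⟨fun hα => ?_, ?_⟩⟩
    · obtain ⟨β, hβ⟩ := exists_permMaps b n α
      exact ⟨β, (h n β).2 ⟨α, hα, hβ⟩, (hba n α β).1 hβ⟩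
    · rintro ⟨β, hβ, hm⟩
      obtain ⟨α', hα', hm'⟩ := (h n β).1 hβ
      rwa [ha.maps_unique hm ((hba n α' β).1 hm')]
  exact ⟨b, hb, fun p q => ⟨key ha hb hba, key hb ha fun n α β => (hba n β α).symm⟩⟩

theorem IsPermSeq.exists_comp_moves {a b : V} (ha : IsPermSeq a) (hb : IsPermSeq b) :
    ∃ c, IsPermSeq c ∧ ∀ p q, Moves c p q ↔ ∃ r, Moves b p r ∧ Moves a r q := by
  obtain ⟨c, hc, h⟩ := ha.exists_comp hb
  have key {p q r : V} (hq : IsCondition q) (hr : Moves b p r) : Moves c p q ↔ Moves a r q := by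
    obtain ⟨-, hpc, hrc, hr⟩ := moves_iff.1 hr
    simp only [moves_iff, ha, hc, hpc, hrc, hq, true_and, h, hr]
    grind
  refine ⟨c, hc, fun p q => ⟨fun hm => ?_, fun ⟨r, hr, hq⟩ => ?_⟩⟩
  · obtain ⟨-, hp, hq, -⟩ := moves_iff.1 hm
    obtain ⟨r, hr, -⟩ := hb.existsUnique_moves hp
    exact ⟨r, hr, (key hq hr).1 hm⟩
  · exact (key (moves_iff.1 hq).2.2.1 hr).2 hq

theorem moves_empty {p q : V} : Moves empty p q ↔ IsCondition p ∧ p = q := by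
  rw [moves_iff]
  simp only [isPermSeq_empty, true_and, PermMaps, not_mem_empty, exists_false, not_false_eq_true,
    false_or, exists_eq_right]
  refine and_congr_right fun hp => ⟨fun ⟨hq, h⟩ => (hq.ext hp h).symm, ?_⟩
  rintro rfl
  exact ⟨hp, fun _ _ => Iff.rfl⟩

theorem Moves.subset_iff {a p q p' q' : V} (hp : Moves a p p') (hq : Moves a q q') :
    (∀ z, z ∈ p → z ∈ q) ↔ ∀ z, z ∈ p' → z ∈ q' := by
  have key {a p q p' q' : V} (hp : Moves a p p') (hq : Moves a q q') (h : ∀ z, z ∈ p → z ∈ q) :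
      ∀ z, z ∈ p' → z ∈ q' := by
    obtain ⟨-, -, hp'c, hp⟩ := moves_iff.1 hp
    obtain ⟨-, -, -, hq⟩ := moves_iff.1 hq
    refine hp'c.subset_iff.2 fun n β hβ => (hq n β).2 ?_
    exact ((hp n β).1 hβ).imp fun α hα => ⟨h _ hα.1, hα.2⟩
  obtain ⟨b, -, hb⟩ := (moves_iff.1 hp).1.exists_inv_moves
  exact ⟨key hp hq, key ((hb _ _).2 hp) ((hb _ _).2 hq)⟩

/-- The forcing notion is homogeneous: every condition `s` has an extension that also extends an
image of a given condition `r` under the group. -/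
theorem IsCondition.exists_moves {s r : V} (hs : IsCondition s) (hr : IsCondition r) :
    ∃ a r' t : V, Moves a r r' ∧ IsCondition t ∧ (∀ z, z ∈ s → z ∈ t) ∧ ∀ z, z ∈ r' → z ∈ t := by
  obtain ⟨t, ht, hst, hrt⟩ := hs.exists_extend hr
  obtain ⟨n, hn, hr'⟩ := isCondition_iff.1 hr
  -- the restriction of `t` to the domain of `r`
  obtain ⟨q, hq, hqm⟩ := exists_isOrdFun n (fun k α => pair k α ∈ t)
    (fun k hk => by
      obtain ⟨α, hα⟩ := hr'.mem_iff.1 hk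
      obtain ⟨β, hβ⟩ := hrt k α hα
      exact ⟨β, hβ, fun γ hγ => ht.eq hγ hβ⟩) fun k α _ h => ht.isOrd h
  have hqc : IsCondition q := ⟨n, hn, hq⟩
  -- the transpositions exchanging `r(k)` and `q(k)`
  have himage (p q : V) (hp : IsCondition p) (hq : IsCondition q) :
      ∃ a : V, ∀ y, y ∈ a ↔ ∃ k, k ∈ n ∧ ∃ α β, pair k α ∈ p ∧ pair k β ∈ q ∧
        y = pair k (pair α β) :=
    exists_image n _ (by
      rintro k - y y' ⟨α, β, h1, h2, rfl⟩ ⟨α', β', h1', h2', rfl⟩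
      rw [hp.eq h1 h1', hq.eq h2 h2'])
  obtain ⟨a₁, ha₁⟩ := himage r q hr hqc
  obtain ⟨a₂, ha₂⟩ := himage q r hqc hr
  have hm (k α β : V) : pair k (pair α β) ∈ bUnion a₁ a₂ ↔
      pair k α ∈ r ∧ pair k β ∈ q ∨ pair k α ∈ q ∧ pair k β ∈ r := by
    rw [mem_bUnion, ha₁, ha₂]
    constructor
    · rintro (⟨k', -, α', β', h1, h2, h⟩ | ⟨k', -, α', β', h1, h2, h⟩) <;>
        simp only [pair_inj] at h <;> obtain ⟨rfl, rfl, rfl⟩ := h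
      exacts [Or.inl ⟨h1, h2⟩, Or.inr ⟨h1, h2⟩]
    · rintro (⟨h1, h2⟩ | ⟨h1, h2⟩)
      · exact Or.inl ⟨k, (hr'.of_pair_mem h1).1, α, β, h1, h2, rfl⟩
      · exact Or.inr ⟨k, (hr'.of_pair_mem h2).1, α, β, h1, h2, rfl⟩
  have hr1 {k α β : V} (h : pair k α ∈ r) (h' : pair k β ∈ r) : α = β := hr.eq h h'
  have hq1 {k α β : V} (h : pair k α ∈ q) (h' : pair k β ∈ q) : α = β := hqc.eq h h'
  have hdom {k α : V} : (∃ β, pair k (pair α β) ∈ bUnion a₁ a₂) ↔ pair k α ∈ r ∨ pair k α ∈ q := by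
    simp only [hm]
    constructor
    · rintro ⟨β, ⟨h, -⟩ | ⟨h, -⟩⟩
      exacts [Or.inl h, Or.inr h]
    · rintro (h | h)
      · obtain ⟨β, hβ⟩ := hq.mem_iff.1 (hr'.of_pair_mem h).1
        exact ⟨β, Or.inl ⟨h, hβ⟩⟩
      · obtain ⟨β, hβ⟩ := hr'.mem_iff.1 (hq.of_pair_mem h).1
        exact ⟨β, Or.inr ⟨h, hβ⟩⟩
  have ha : IsPermSeq (bUnion a₁ a₂) := by
    refine ⟨fun z hz => ?_, fun k α β β' h h' => ?_, fun k α α' β h h' => ?_, fun k α => ?_⟩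
    · rcases mem_bUnion.1 hz with h | h
      · obtain ⟨k, -, α, β, h1, h2, rfl⟩ := (ha₁ z).1 h
        exact ⟨k, α, β, hr.isNat h1, hr.isOrd h1, hqc.isOrd h2, rfl⟩
      · obtain ⟨k, -, α, β, h1, h2, rfl⟩ := (ha₂ z).1 h
        exact ⟨k, α, β, hr.isNat h2, hqc.isOrd h1, hr.isOrd h2, rfl⟩
    · rcases (hm _ _ _).1 h with ⟨h1, h2⟩ | ⟨h1, h2⟩ <;>
        rcases (hm _ _ _).1 h' with ⟨h1', h2'⟩ | ⟨h1', h2'⟩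
      · exact hq1 h2 h2'
      · rw [hq1 h2 h1', hr1 h1 h2']
      · rw [hr1 h2 h1', hq1 h1 h2']
      · exact hr1 h2 h2'
    · rcases (hm _ _ _).1 h with ⟨h1, h2⟩ | ⟨h1, h2⟩ <;>
        rcases (hm _ _ _).1 h' with ⟨h1', h2'⟩ | ⟨h1', h2'⟩
      · exact hr1 h1 h1'
      · rw [hr1 h1 h2', hq1 h2 h1']
      · rw [hq1 h1 h2', hr1 h2 h1']
      · exact hq1 h1 h1'
    · simp only [hm, and_comm, or_comm]
  refine ⟨_, q, t, moves_iff.2 ⟨ha, hr, hqc, fun k β => ⟨fun hβ => ?_, ?_⟩⟩, ht, hst,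
    hqc.subset_iff.2 fun k α hk => ((hqm k α).1 hk).2⟩
  · obtain ⟨α, hα⟩ := hr'.mem_iff.1 (hq.of_pair_mem hβ).1
    exact ⟨α, hα, Or.inl ((hm _ _ _).2 (Or.inl ⟨hα, hβ⟩))⟩
  · rintro ⟨α, hα, h | ⟨h, -⟩⟩
    · rcases (hm _ _ _).1 h with ⟨h1, h2⟩ | ⟨h1, h2⟩
      · exact h2
      · rw [hr1 h2 hα]
        exact h1
    · exact (h (hdom.2 (Or.inl hα))).elim

/-! ### The symmetric system -/

theorem le_iff {q p : V} : (cofinalSystem V).le q p ↔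
    IsCondition q ∧ IsCondition p ∧ ∀ z : V, z ∈ p → z ∈ q := Iff.rfl

theorem autC_eq (a : V) : (cofinalSystem V).autC a = Moves a := rfl

theorem le_trans {p q r : V} (h : (cofinalSystem V).le p q) (h' : (cofinalSystem V).le q r) :
    (cofinalSystem V).le p r :=
  ⟨h.1, h'.2.1, fun z hz => h.2.2 z (h'.2.2 z hz)⟩

theorem le_refl {p : V} (h : IsCondition p) : (cofinalSystem V).le p p := ⟨h, h, fun _ hz => hz⟩

theorem mem_autIdx {a : V} : a ∈ (cofinalSystem V).autIdx ↔ IsPermSeq a := by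
  refine ⟨fun ⟨p, q, h⟩ => h.1, fun ha => ?_⟩
  obtain ⟨q, hq, -⟩ := ha.existsUnique_moves isCondition_empty
  exact ⟨empty, q, hq⟩

theorem mem_filIdx {a : V} : a ∈ (cofinalSystem V).filIdx ↔ a = empty :=
  ⟨fun ⟨_, h⟩ => h.1, fun h => ⟨empty, h, isPermSeq_empty⟩⟩

theorem mem_group {π : V → V → Prop} :
    π ∈ (cofinalSystem V).group ↔ ∃ a, IsPermSeq a ∧ π = Moves a := by
  simp only [SystemData.group, Set.mem_ofPred_eq, mem_autIdx, autC_eq]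

theorem basic_eq_group : (cofinalSystem V).basic empty = (cofinalSystem V).group := by
  ext π
  rw [mem_group]
  exact ⟨fun ⟨d, hd, h⟩ => ⟨d, hd.2, h⟩, fun ⟨d, hd, h⟩ => ⟨d, ⟨rfl, hd⟩, h⟩⟩

theorem isSubgroup_group : (cofinalSystem V).IsSubgroup (cofinalSystem V).group := by
  refine ⟨subset_rfl, mem_group.2 ⟨empty, isPermSeq_empty, ?_⟩, fun π hπ σ hσ => ?_,
    fun π hπ => ?_⟩
  · funext p q
    exact propext moves_empty.symm
  · obtain ⟨a, ha, rfl⟩ := mem_group.1 hπ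
    obtain ⟨b, hb, rfl⟩ := mem_group.1 hσ
    obtain ⟨c, hc, h⟩ := ha.exists_comp_moves hb
    exact mem_group.2 ⟨c, hc, funext fun p => funext fun q => propext (h p q).symm⟩
  · obtain ⟨a, ha, rfl⟩ := mem_group.1 hπ
    obtain ⟨b, hb, h⟩ := ha.exists_inv_moves
    exact mem_group.2 ⟨b, hb, funext fun p => funext fun q => propext (h p q).symm⟩

theorem isAutomorphism_moves {a : V} (ha : IsPermSeq a) :
    (cofinalSystem V).IsAutomorphism (Moves a) := by
  obtain ⟨b, hb, h⟩ := ha.exists_inv_moves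
  refine ⟨fun p q h => ⟨h.2.1, h.2.2.1⟩, fun p hp => ha.existsUnique_moves hp, fun q hq => ?_,
    fun p q p' q' hp hq => ?_⟩
  · simp only [← h]
    exact hb.existsUnique_moves hq
  · rw [le_iff, le_iff, Moves.subset_iff hq hp]
    simp only [hp.2.1, hq.2.1, hp.2.2.1, hq.2.2.1, true_and]

theorem isClassSymmetricSystem : (cofinalSystem V).IsClassSymmetricSystem where
  isClass_P := isClass_setOf IsCondition
  isClass_le := by
    unfold IsClass₂
    simp only [le_iff]
    exact isClass_setOf _
  le_mem p q h := ⟨h.1, h.2.1⟩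
  le_refl p hp := le_refl hp
  le_trans p q r h h' := le_trans h h'
  one_mem := isCondition_empty
  le_one p hp := ⟨hp, isCondition_empty, fun z hz => (not_mem_empty z hz).elim⟩
  isClass_aut := isClass_setOf fun z => ∃ a b c : V, Moves a b c ∧ z = pair a (pair b c)
  aut a ha := isAutomorphism_moves (mem_autIdx.1 ha)
  group_isSubgroup := isSubgroup_group
  isClass_fil :=
    isClass_setOf fun z : V => ∃ a b : V, (a = empty ∧ IsPermSeq b) ∧ z = pair a b
  fil_idx a d h := mem_autIdx.2 h.2
  basic_isSubgroup a ha := by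
    rw [mem_filIdx.1 ha, basic_eq_group]
    exact isSubgroup_group
  exists_basic_eq_group := ⟨empty, mem_filIdx.2 rfl, basic_eq_group⟩
  exists_basic_subset_inter a ha b hb := by
    rw [mem_filIdx.1 ha, mem_filIdx.1 hb]
    exact ⟨empty, mem_filIdx.2 rfl, fun π h => ⟨h, h⟩⟩
  normal a ha d hd := by
    -- every `τ` in the group is the conjugate of `d⁻¹ τ d`
    refine ⟨empty, mem_filIdx.2 rfl, fun τ hτ => ?_⟩
    rw [basic_eq_group] at hτ
    rw [mem_filIdx.1 ha, basic_eq_group]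
    have hd' : Moves d ∈ (cofinalSystem V).group := mem_group.2 ⟨d, mem_autIdx.1 hd, rfl⟩
    have hG := isSubgroup_group (V := V)
    refine ⟨compMap (invMap (Moves d)) (compMap τ (Moves d)),
      hG.2.2.1 _ (hG.2.2.2 _ hd') _ (hG.2.2.1 _ hτ _ hd'), ?_⟩
    have hda := isAutomorphism_moves (mem_autIdx.1 hd)
    obtain ⟨b, hb, rfl⟩ := mem_group.1 hτ
    have hba := isAutomorphism_moves hb
    funext p q
    refine propext ⟨fun h => ?_, ?_⟩
    · obtain ⟨p', hp', -⟩ := hda.2.2.1 p (hba.1 p q h).1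
      obtain ⟨q', hq', -⟩ := hda.2.2.1 q (hba.1 p q h).2
      exact ⟨q', ⟨p', hp', q, ⟨p, hp', h⟩, hq'⟩, hq'⟩
    · rintro ⟨q', ⟨p', hp', q'', ⟨p'', hp'', h⟩, hq''⟩, hq'⟩
      rwa [(hda.2.1 _ (hda.1 _ _ hp').1).unique hp' hp'',
        (hda.2.1 _ (hda.1 _ _ hq').1).unique hq' hq'']

theorem mem_filter {H : Set (V → V → Prop)} :
    H ∈ (cofinalSystem V).filter ↔ H = (cofinalSystem V).group := by
  constructor
  · rintro ⟨h, -, a, ha, hH⟩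
    rw [mem_filIdx.1 ha, basic_eq_group] at hH
    exact h.1.antisymm hH
  · rintro rfl
    refine ⟨isSubgroup_group, ⟨{a | IsPermSeq a}, isClass_setOf _, fun a ha => mem_autIdx.2 ha,
      ?_⟩, empty, mem_filIdx.2 rfl, basic_eq_group.subset⟩
    ext π
    exact mem_group

/-- As the only group in the filter is the whole group, a property of automorphisms holds on a
group in the filter if and only if it holds for all automorphisms. -/
theorem sep_mem_filter {Q : (V → V → Prop) → Prop} :
    {π | π ∈ (cofinalSystem V).group ∧ Q π} ∈ (cofinalSystem V).filter ↔
      ∀ a, IsPermSeq a → Q (Moves a) := by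
  rw [mem_filter, Set.ext_iff]
  simp only [Set.mem_ofPred_eq, and_iff_left_iff_imp, mem_group]
  exact ⟨fun h a ha => h _ ⟨a, ha, rfl⟩, by rintro h _ ⟨a, ha, rfl⟩; exact h a ha⟩

theorem symmetricName_iff {x : V} :
    (cofinalSystem V).SymmetricName x ↔ ∀ a, IsPermSeq a → IsNameImage (Moves a) x x :=
  sep_mem_filter

theorem symmetricClassName_iff {Γ : Set V} : (cofinalSystem V).SymmetricClassName Γ ↔
    ∀ a, IsPermSeq a → classNameImage (Moves a) Γ = Γ :=
  sep_mem_filter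

/-! ### Hereditarily symmetric names -/

theorem isNameImage_of_mem_HS {x a : V} (hx : x ∈ (cofinalSystem V).HS) (ha : IsPermSeq a) :
    IsNameImage (Moves a) x x := by
  obtain ⟨t, hxt, ht⟩ := hx
  exact symmetricName_iff.1 (ht x hxt).2 a ha

theorem mem_HS_of_pair_mem {x w p : V} (hx : x ∈ (cofinalSystem V).HS) (h : pair w p ∈ x) :
    w ∈ (cofinalSystem V).HS ∧ IsCondition p := by
  obtain ⟨t, hxt, ht⟩ := hx
  obtain ⟨y, q, hy, hq, he⟩ := (ht x hxt).1 _ h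
  obtain ⟨rfl, rfl⟩ := pair_inj.1 he
  exact ⟨⟨t, hy, ht⟩, hq⟩

theorem moves_empty_left {a p : V} (ha : IsPermSeq a) : Moves a empty p ↔ p = empty := by
  rw [moves_iff]
  simp only [ha, isCondition_empty, true_and, not_mem_empty, false_and, exists_false, iff_false]
  constructor
  · rintro ⟨hp, h⟩
    refine eq_of_mem_iff fun z => iff_of_false (fun hz => ?_) (not_mem_empty z)
    obtain ⟨k, α, rfl⟩ := hp.eq_pair hz
    exact h k α hz
  · rintro rfl
    exact ⟨isCondition_empty, fun _ _ => not_mem_empty _⟩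

theorem check_isNameImage {x y a : V} (h : IsCheckName empty x y) (ha : IsPermSeq a) :
    IsNameImage (Moves a) y y :=
  h.isNameImage fun _ => moves_empty_left ha

theorem check_mem_HS {x y : V} (h : IsCheckName empty x y) : y ∈ (cofinalSystem V).HS := by
  obtain ⟨f, hf, h⟩ := isCheckName_iff.1 h
  -- the range of the recursive function is closed under passing to names in the domain
  obtain ⟨t, ht⟩ := exists_sep (field f) fun v => ∃ u, pair u v ∈ f
  have ht' (v : V) : v ∈ t ↔ ∃ u, pair u v ∈ f :=
    (ht v).trans (and_iff_right_of_imp fun ⟨_, hu⟩ => (mem_field hu).2)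
  refine ⟨t, (ht' y).2 ⟨x, h⟩, fun v hv => ?_⟩
  obtain ⟨u, hu⟩ := (ht' v).1 hv
  refine ⟨fun z hz => ?_, symmetricName_iff.2 fun a ha =>
    check_isNameImage (isCheckName_iff.2 ⟨f, hf, hu⟩) ha⟩
  obtain ⟨w, w', -, hw, rfl⟩ := ((hf.2.2 u v hu).2 z).1 hz
  exact ⟨w', empty, (ht' w').2 ⟨w, hw⟩, isCondition_empty, rfl⟩

theorem exists_mem_HS_val_eq (x : V) : ∃ y ∈ (cofinalSystem V).HS, val y = x := by
  obtain ⟨y, hy⟩ := exists_isCheckName empty x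
  exact ⟨y, check_mem_HS hy, val_of_isCheckName hy⟩

theorem isClassName_classCheckName {A : Set V} (hA : IsClass A) :
    (cofinalSystem V).IsClassName (classCheckName empty A) := by
  have : Fact (IsClass A) := ⟨hA⟩
  refine ⟨isClass_setOf _, ?_, symmetricClassName_iff.2 fun a ha => ?_⟩
  · rintro z ⟨x, y, -, hy, rfl⟩
    exact ⟨y, check_mem_HS hy, empty, isCondition_empty, rfl⟩
  · ext z
    constructor
    · rintro ⟨w, p, w', p', ⟨x, y, hx, hy, he⟩, hw, hp, rfl⟩
      obtain ⟨rfl, rfl⟩ := pair_inj.1 he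
      refine ⟨x, w, hx, hy, ?_⟩
      rw [(moves_empty_left ha).1 hp, hw.unique (check_isNameImage hy ha)]
    · rintro ⟨x, y, hx, hy, rfl⟩
      exact ⟨y, empty, y, empty, ⟨x, y, hx, hy, rfl⟩, check_isNameImage hy ha,
        (moves_empty_left ha).2 rfl, rfl⟩

/-! ### The forcing relation -/

/-- If `⟨z, r⟩` is in a hereditarily symmetric name `x`, then it is dense that `z` is put into
the interpretation of `x`. -/
theorem exists_le_of_pair_mem {x z r s : V} (hx : x ∈ (cofinalSystem V).HS) (h : pair z r ∈ x)
    (hs : IsCondition s) : ∃ t r' : V, (cofinalSystem V).le t s ∧ (cofinalSystem V).le t r' ∧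
      pair z r' ∈ x := by
  have hz := mem_HS_of_pair_mem hx h
  obtain ⟨a, r', t, hm, ht, hst, hrt⟩ := hs.exists_moves hz.2
  obtain ⟨ha, -, hr', -⟩ := moves_iff.1 hm
  exact ⟨t, r', ⟨ht, hs, hst⟩, ⟨ht, hr', hrt⟩,
    (isNameImage_of_mem_HS hx ha).pair_mem (isNameImage_of_mem_HS hz.1 ha) h hm⟩

/-- The analogue of `exists_le_of_pair_mem` for class names. -/
theorem exists_le_of_pair_mem_class {Γ : Set V} {z r s : V} (hΓ : (cofinalSystem V).IsClassName Γ)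
    (h : pair z r ∈ Γ) (hs : IsCondition s) : ∃ t r' : V, (cofinalSystem V).le t s ∧
      (cofinalSystem V).le t r' ∧ pair z r' ∈ Γ := by
  obtain ⟨z', hz, r₁, hr, he⟩ := hΓ.2.1 _ h
  obtain ⟨rfl, rfl⟩ := pair_inj.1 he
  obtain ⟨a, r', t, hm, ht, hst, hrt⟩ := hs.exists_moves hr
  obtain ⟨ha, -, hr', -⟩ := moves_iff.1 hm
  refine ⟨t, r', ⟨ht, hs, hst⟩, ⟨ht, hr', hrt⟩, ?_⟩
  rw [← symmetricClassName_iff.1 hΓ.2.2 a ha]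
  exact ⟨z, r, z, r', h, isNameImage_of_mem_HS hz ha, hm, rfl⟩

/-- The forcing relation for atomic formulas: by homogeneity, it does not depend on the condition,
and says that the relation holds between the evaluations of the names. -/
def AtomForces (_p : V) : AtomRel → V → V → Prop
  | .mem, x, y => val x ∈ val y
  | .sub, x, y => ∀ z, z ∈ val x → z ∈ val y
  | .eq, x, y => val x = val y

theorem isAtomicForcing : (cofinalSystem V).IsAtomicForcing AtomForces where
  isClass ρ := by
    unfold IsClass₃
    cases ρ <;> simp only [AtomForces] <;> exact isClass_setOf _
  mem_iff p hp x hx y hy := by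
    simp only [AtomForces, mem_val (u := y)]
    constructor
    · rintro ⟨w, r, h, he⟩ s hs
      obtain ⟨t, r', hts, htr, h'⟩ := exists_le_of_pair_mem hy h hs.1
      exact ⟨t, ⟨hts.1, w, r', h', htr, he⟩, hts⟩
    · intro h
      obtain ⟨q, ⟨-, z, r, h, -, he⟩, -⟩ := h p (le_refl hp)
      exact ⟨z, r, h, he⟩
  sub_iff p hp x hx y hy := by
    simp only [AtomForces]
    constructor
    · intro h z r hz s hs _
      exact ⟨s, le_refl hs.1, h _ (mem_val.2 ⟨z, r, hz, rfl⟩)⟩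
    · intro h _ hz
      obtain ⟨w, r, hw, rfl⟩ := mem_val.1 hz
      obtain ⟨t, r', htp, htr, hw'⟩ := exists_le_of_pair_mem hx hw hp
      obtain ⟨q, -, hq⟩ := h w r' hw' t htp htr
      exact hq
  eq_iff p hp x hx y hy := by
    simp only [AtomForces]
    exact ⟨fun h => ⟨fun z hz => h ▸ hz, fun z hz => h.symm ▸ hz⟩,
      fun h => eq_of_mem_iff fun z => ⟨h.1 z, h.2 z⟩⟩

/-- The evaluation of a class name. -/
def classVal (Γ : Set V) : Set V := {y | ∃ z s, pair z s ∈ Γ ∧ y = val z}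

theorem isClass_classVal {Γ : Set V} (hΓ : IsClass Γ) : IsClass (classVal Γ) := by
  have : Fact (IsClass Γ) := ⟨hΓ⟩
  exact isClass_setOf _

theorem classVal_classCheckName (A : Set V) : classVal (classCheckName empty A) = A := by
  ext z
  constructor
  · rintro ⟨y, s, ⟨x, y', hx, hy, he⟩, rfl⟩
    obtain ⟨rfl, rfl⟩ := pair_inj.1 he
    rwa [val_of_isCheckName hy]
  · intro hz
    obtain ⟨y, hy⟩ := exists_isCheckName empty z
    exact ⟨y, empty, ⟨z, y, hz, hy, rfl⟩, (val_of_isCheckName hy).symm⟩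

/-- The truth lemma: every condition decides every formula about hereditarily symmetric names
according to its truth in the ground model for the evaluations of the names. -/
theorem forces_iff {Γ : ℕ → Set V} (hΓ : ∀ k, (cofinalSystem V).IsClassName (Γ k)) (φ : Fml)
    {p : V} (hp : IsCondition p) {v : ℕ → V} (hv : ∀ i, v i ∈ (cofinalSystem V).HS) :
    (cofinalSystem V).Forces AtomForces φ p v Γ ↔
      φ.Sat (fun i => val (v i)) fun k => classVal (Γ k) := by
  induction φ generalizing p v with
  | mem i j => exact Iff.rfl
  | eq i j => exact Iff.rfl
  | memC i k =>
    constructor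
    · intro h
      obtain ⟨r, -, z, s, hz, -, he⟩ := h p (le_refl hp)
      exact ⟨z, s, hz, he⟩
    · rintro ⟨z, s, hz, he⟩ q hq
      obtain ⟨t, s', htq, hts, hz'⟩ := exists_le_of_pair_mem_class (hΓ k) hz hq.1
      exact ⟨t, htq, z, s', hz', hts, he⟩
  | and φ ψ ihφ ihψ => exact and_congr (ihφ hp hv) (ihψ hp hv)
  | neg φ ih =>
    constructor
    · exact fun h h' => h p (le_refl hp) ((ih hp hv).2 h')
    · exact fun h q hq h' => h ((ih hq.1 hv).1 h')
  | ex i φ ih =>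
    have key {q : V} (hq : IsCondition q) {z : V} (hz : z ∈ (cofinalSystem V).HS) :
        (cofinalSystem V).Forces AtomForces φ q (Function.update v i z) Γ ↔
          φ.Sat (Function.update (fun i => val (v i)) i (val z)) fun k => classVal (Γ k) := by
      rw [ih hq (Function.forall_update_iff v _ |>.2 ⟨hz, fun j _ => hv j⟩)]
      refine iff_of_eq (congrArg (φ.Sat · _) (funext fun j => ?_))
      by_cases hj : j = i
      · subst hj; simp
      · simp [hj]
    constructor
    · intro h
      obtain ⟨r, hr, z, hz, hf⟩ := h p (le_refl hp)
      exact ⟨val z, (key hr.1 hz).1 hf⟩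
    · rintro ⟨x, hx⟩ q hq
      obtain ⟨z, hz, rfl⟩ := exists_mem_HS_val_eq x
      exact ⟨q, le_refl hq.1, z, hz, (key hq.1 hz).2 hx⟩

theorem admitsForcingRelations : (cofinalSystem V).AdmitsForcingRelations AtomForces := by
  refine ⟨isAtomicForcing, fun L Γ hΓ => ?_⟩
  obtain ⟨F, hF, h⟩ := isClass_sat_val L (fun k => classVal (Γ k)) fun k =>
    isClass_classVal (hΓ k).1
  exact ⟨F, hF, fun φ hφ p hp v hv => (h φ hφ p v).trans (forces_iff hΓ φ hp hv).symm⟩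

theorem addsNoNewClasses : (cofinalSystem V).AddsNoNewClasses := by
  refine ⟨_, admitsForcingRelations, fun Γ hΓ => ?_⟩
  have hA := isClass_classVal hΓ.1
  refine ⟨classVal Γ, hA, isClassName_classCheckName hA, fun v hv => ?_⟩
  refine (forces_iff (fun k => ?_) _ isCondition_empty hv).2 ?_
  · split_ifs
    exacts [hΓ, isClassName_classCheckName hA]
  · have h1 : classVal (classCheckName (cofinalSystem V).one (classVal Γ)) = classVal Γ :=
      classVal_classCheckName _
    simp [Fml.eqC, Fml.all, Fml.iff, Fml.imp, Fml.Sat, h1]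

theorem sat_isPair {w u v : ℕ} (hw : w ≠ 8 ∧ w ≠ 9) (hu : u ≠ 8 ∧ u ≠ 9) (hv : v ≠ 8 ∧ v ≠ 9)
    (e : ℕ → V) (C : ℕ → Set V) :
    (Fml.isPair w u v).Sat e C ↔ IsOrderedPair (e w) (e u) (e v) := by
  simp only [Fml.isPair, Fml.isUnordered, Fml.all, Fml.iff, Fml.imp, Fml.or, Fml.Sat,
    IsOrderedPair, Function.update_apply, hw, hu, hv, if_false, if_true]
  simp
  grind

theorem sat_separationFml {A : Set V} (hA : IsClass A) (e : ℕ → V) :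
    Fml.separationFml.Sat e fun _ => A := by
  simp only [Fml.separationFml, Fml.all, Fml.iff, Fml.imp, Fml.Sat, Function.update_apply]
  simp
  intro x
  obtain ⟨b, hb⟩ := separation x A hA
  exact ⟨b, fun z => by grind⟩

theorem sat_pairMemC {u v : ℕ} (hu : u < 7) (hv : v < 7) (e : ℕ → V) (C : ℕ → Set V) :
    (Fml.pairMemC u v).Sat e C ↔ ∃ z ∈ C 0, IsOrderedPair z (e u) (e v) := by
  refine exists_congr fun z => ?_
  rw [Fml.Sat, sat_isPair (by decide) (by omega) (by omega)]
  simp [Fml.Sat, hu.ne, hv.ne]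

theorem sat_collectionFml {A : Set V} (hA : IsClass A) (e : ℕ → V) :
    Fml.collectionFml.Sat e fun _ => A := by
  simp only [Fml.collectionFml, Fml.all, Fml.imp, Fml.Sat, not_exists_not, not_and_not_right]
  rintro a ⟨-, hR⟩
  obtain ⟨b, hb⟩ := collection a A hA fun x hx => by
    obtain ⟨y, hy⟩ := hR x (by simpa using hx)
    rw [sat_pairMemC (by decide) (by decide)] at hy
    exact ⟨y, by simpa using hy⟩
  refine ⟨b, fun x hx => ?_⟩
  obtain ⟨y, hy, hz⟩ := hb x (by simpa using hx)
  refine ⟨y, by simpa using hy, ?_⟩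
  rw [sat_pairMemC (by decide) (by decide)]
  simpa using hz

theorem pretame : (cofinalSystem V).Pretame := by
  refine ⟨_, admitsForcingRelations, fun Γ hΓ v hv => ⟨?_, ?_⟩⟩
  · exact (forces_iff (fun _ => hΓ) _ isCondition_empty hv).2
      (sat_separationFml (isClass_classVal hΓ.1) _)
  · exact (forces_iff (fun _ => hΓ) _ isCondition_empty hv).2
      (sat_collectionFml (isClass_classVal hΓ.1) _)

/-! ### Failure of combinatorial pretameness -/

/-- A counterexample to pretameness: the classes `D_ň` of conditions with `n` in their domain,
indexed by the canonical names of the natural numbers. -/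
theorem exists_not_hasPredenseRefinements : ∃ (I : V) (D : Set V),
    (cofinalSystem V).IsDenseSequence I D ∧ (cofinalSystem V).IsSymmetricSequence I D ∧
      ¬ (cofinalSystem V).HasPredenseRefinements I D := by
  obtain ⟨I, hI⟩ := exists_image (omega : V) (fun n i => IsCheckName empty n i)
    fun n _ i i' h h' => h.unique h'
  have hI' (i : V) : i ∈ I ↔ ∃ n, IsNat n ∧ IsCheckName empty n i := by
    simp only [hI, mem_omega]
  set D : Set V := {z | ∃ i d : V, i ∈ I ∧ IsCondition d ∧ (∃ α, pair (val i) α ∈ d) ∧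
    z = pair i d} with hD
  have hsect {n i : V} (hn : IsNat n) (hi : IsCheckName empty n i) (d : V) :
      d ∈ sect D i ↔ IsCondition d ∧ ∃ α, pair n α ∈ d := by
    constructor
    · rintro ⟨i', d', -, h1, h2, he⟩
      obtain ⟨rfl, rfl⟩ := pair_inj.1 he
      rw [val_of_isCheckName hi] at h2
      exact ⟨h1, h2⟩
    · rintro ⟨h1, h2⟩
      exact ⟨i, d, (hI' i).2 ⟨n, hn, hi⟩, h1, (val_of_isCheckName hi).symm ▸ h2, rfl⟩
  refine ⟨I, D, ⟨isClass_setOf _, ?_, fun i hi => ?_⟩, ⟨fun i hi => ?_, ?_, ?_⟩, fun h => ?_⟩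
  · rintro z ⟨i, d, hi, hd, -, rfl⟩
    exact ⟨i, d, hi, hd, rfl⟩
  · obtain ⟨n, hn, hi⟩ := (hI' i).1 hi
    refine ⟨fun d hd => ((hsect hn hi d).1 hd).1, fun p hp => ?_⟩
    obtain ⟨t, ht, hpt, hn'⟩ := hp.exists_extend_mem hn
    exact ⟨t, (hsect hn hi t).2 ⟨ht, hn'⟩, ht, hp, hpt⟩
  · obtain ⟨n, hn, hi⟩ := (hI' i).1 hi
    exact check_mem_HS hi
  · have : {z : V | ∃ i : V, i ∈ I ∧ z = pair i (cofinalSystem V).one} =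
        classCheckName empty {n | IsNat n} := by
      ext z
      simp only [hI', classCheckName, Set.mem_ofPred_eq]
      constructor
      · rintro ⟨i, ⟨n, hn, hi⟩, rfl⟩
        exact ⟨n, i, hn, hi, rfl⟩
      · rintro ⟨n, i, hn, hi, rfl⟩
        exact ⟨i, ⟨n, hn, hi⟩, rfl⟩
    rw [this]
    exact (isClassName_classCheckName (isClass_setOf _)).2.2
  · refine ⟨_, mem_filter.2 rfl, fun π hπ i hi => ⟨i, hi, ?_⟩⟩
    obtain ⟨a, ha, rfl⟩ := mem_group.1 hπ
    obtain ⟨n, hn, hi⟩ := (hI' i).1 hi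
    refine ⟨check_isNameImage hi ha, ?_⟩
    ext q
    simp only [Set.mem_ofPred_eq, hsect hn hi]
    constructor
    · rintro ⟨p, ⟨-, hp⟩, hm⟩
      exact ⟨hm.2.2.1, (hm.2.2.2.1 n).1 hp⟩
    · rintro ⟨hq, hn'⟩
      obtain ⟨p, hm, -⟩ := (isAutomorphism_moves ha).2.2.1 q hq
      exact ⟨p, ⟨hm.2.1, (hm.2.2.2.1 n).2 hn'⟩, hm⟩
  · obtain ⟨q, ⟨hq, -, -⟩, s, hs⟩ := h empty isCondition_empty
    obtain ⟨n, hn, hqn⟩ := isCondition_iff.1 hq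
    obtain ⟨i, hi⟩ := exists_isCheckName empty n
    obtain ⟨hsub, hpre⟩ := hs i ((hI' i).2 ⟨n, hn, hi⟩)
    -- `α` is not a value at `n`, the length of `q`, of any element of the set `d_ň`
    obtain ⟨α, hα, hαs⟩ := exists_isOrd_not_mem (field (sUnion (field s)))
    have hqn' (β : V) : ¬ pair n β ∈ q := fun h => not_mem_self n (hqn.of_pair_mem h).1
    have hF : ∀ k, k ∈ succ n → ∃! β, pair k β ∈ q ∨ k = n ∧ β = α := by
      intro k hk
      rcases (mem_succ n k).1 hk with hk | rfl
      · have hkn : k ≠ n := fun h => not_mem_self n (h ▸ hk)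
        simpa [hkn] using hqn.2 k hk
      · simp [hqn']
    obtain ⟨r, hr, hrm⟩ := exists_isOrdFun (succ n) _ hF fun k β _ h =>
      h.elim hq.isOrd fun h => h.2 ▸ hα
    have hrc : IsCondition r := ⟨succ n, hn.succ, hr⟩
    obtain ⟨d, hd, t, htr, htd⟩ := hpre r ⟨hrc, hq, hq.subset_iff.2 fun k β hk =>
      (hrm k β).2 ⟨(mem_succ n k).2 (Or.inl (hqn.of_pair_mem hk).1), Or.inl hk⟩⟩
    obtain ⟨-, β, hβ⟩ := (hsect hn hi d).1 (hsub hd)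
    have hα' : pair n α ∈ t :=
      htr.2.2 _ ((hrm n α).2 ⟨(mem_succ n n).2 (Or.inr rfl), Or.inr ⟨rfl, rfl⟩⟩)
    rw [htr.1.eq hα' (htd.2.2 _ hβ)] at hαs
    exact hαs (mem_field (mem_sUnion.2 ⟨d, (mem_field hd).2, hβ⟩)).2

end GBModel

theorem mainTheorem6 (V : Type*) [GBModel V] :
    (GBModel.cofinalSystem V).IsClassSymmetricSystem ∧
    ¬ (GBModel.cofinalSystem V).PretameForcing ∧
    (GBModel.cofinalSystem V).AddsNoNewClasses ∧
    (GBModel.cofinalSystem V).Pretame ∧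
    ¬ (GBModel.cofinalSystem V).CombinatoriallyPretame := by
  obtain ⟨I, D, hD, hsymm, hnot⟩ := GBModel.exists_not_hasPredenseRefinements (V := V)
  exact ⟨GBModel.isClassSymmetricSystem, fun h => hnot (h I D hD), GBModel.addsNoNewClasses,
    GBModel.pretame, fun h => hnot (h I D hD hsymm)⟩
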